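/- Let $m\ge 1$ be an integer, let $\Omega\subset\mathbb R$ be one of $\mathbb R$, $(-\infty,L_1)$, $(L_2,\infty)$ with $L_1,L_2\in\mathbb R$, and let $v\in C^m(\overline\Omega;\mathbb R)$ (derivatives being one-sided at a boundary point) satisfy $$|v'(y)|+|v''(y)|+\cdots+|v^{(m)}(y)|>0\quad\text{for all } y\in\overline\Omega,\qquad\text{and}\qquad \liminf_{|y|\to\infty,\ y\in\overline\Omega}|v'(y)|\ge c_0\ \text{ for some } c_0>0.$$ For $\nu>0$ and $k\in\mathbb R\setminus\{0\}$, let $H_{\nu,k}$ be the operator on $X=L^2(\Omega;\mathbb C)$ given by $H_{\nu,k}g=-\nu g''+\mathrm i k\,v\,g$ with homogeneous Neumann boundary conditions; precisely, $H_{\nu,k}$ is the closure of this differential operator on the domain $$\{g\in H^2(\Omega):\ g'=0 \text{ on } \partial\Omega,\ vg\in L^2(\Omega)\}.$$ Define its pseudospectral abscissa by $$\Psi(H_{\nu,k})=\Bigl(\sup_{z\in \mathrm i\mathbb R}\|(H_{\nu,k}-z)^{-1}\|_{X\to X}\Bigr)^{-1},$$ where $\|(H_{\nu,k}-z)^{-1}\|=\infty$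 if $z$ belongs to the spectrum of $H_{\nu,k}$ (and $\infty^{-1}=0$), and set $$\lambda_{\nu,k}=\begin{cases}\nu^{\frac{m}{m+2}}|k|^{\frac{2}{m+2}}, & 0<\nu\le |k|,\\[2pt] \dfrac{k^2}{\nu}, & 0<|k|\le\nu.\end{cases}$$ Then there exists a constant $C>0$, depending only on $m$, $\Omega$ and $v$, such that for all $\nu>0$ and all $k\neq 0$, $$\Psi(H_{\nu,k})\ \ge\ C\,\lambda_{\nu,k}.$$ -/

import Mathlib

open MeasureTheory Filter Set TopologicalSpace
open scoped ENNReal ContDiff Topology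

noncomputable section

namespace ShearFlow

/-- The Hilbert space `X = L²(Ω; ℂ)` for an open set `Ω ⊆ ℝ` with Lebesgue measure. -/
abbrev X (Ω : Opens ℝ) : Type := Lp ℂ 2 (volume.restrict (Ω : Set ℝ))

/-- `g₁ ∈ L²(Ω)` is the weak (distributional) derivative of `g ∈ L²(Ω)` on `Ω`. -/
def IsWeakDeriv (Ω : Opens ℝ) (g g₁ : X Ω) : Prop :=
  ∀ φ : ℝ → ℝ, ContDiff ℝ ∞ φ → HasCompactSupport φ → tsupport φ ⊆ (Ω : Set ℝ) →
    ∫ y in (Ω : Set ℝ), deriv φ y • g y = - ∫ y in (Ω : Set ℝ), φ y • g₁ y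

/-- Vanishing trace on `∂Ω`: `w` has a representative which is continuous on the closure of `Ω`
and is zero at every boundary point. (On an interval, a function of class `H¹` always has a
representative continuous up to the boundary.) -/
def HasZeroTrace (Ω : Opens ℝ) (w : X Ω) : Prop :=
  ∃ u : ℝ → ℂ, ContinuousOn u (closure (Ω : Set ℝ)) ∧
    (∀ᵐ y ∂(volume.restrict (Ω : Set ℝ)), w y = u y) ∧
    ∀ y ∈ frontier (Ω : Set ℝ), u y = 0

lemma integrable_smul_of_test {Ω : Opens ℝ} (g : X Ω) {φ : ℝ → ℝ} (hφ : Continuous φ)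
    (hc : HasCompactSupport φ) :
    Integrable (fun y => φ y • g y) (volume.restrict (Ω : Set ℝ)) := by
  have h1 : MemLp φ 2 (volume.restrict (Ω : Set ℝ)) :=
    (hφ.memLp_of_hasCompactSupport hc (p := 2) (μ := volume)).restrict _
  exact MemLp.integrable_mul (f := fun y => (φ y : ℂ)) (p := 2) (q := 2)
    h1.ofReal (Lp.memLp g) |>.congr (by filter_upwards with y; simp)

lemma IsWeakDeriv.add {Ω : Opens ℝ} {g g₁ h h₁ : X Ω} (hg : IsWeakDeriv Ω g g₁)
    (hh : IsWeakDeriv Ω h h₁) : IsWeakDeriv Ω (g + h) (g₁ + h₁) := by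
  intro φ h1 h2 h3
  have key : ∀ (a b : X Ω) (ψ : ℝ → ℝ), Continuous ψ → HasCompactSupport ψ →
      ∫ y in (Ω : Set ℝ), ψ y • (a + b : X Ω) y
        = (∫ y in (Ω : Set ℝ), ψ y • a y) + ∫ y in (Ω : Set ℝ), ψ y • b y := by
    intro a b ψ hψ hc
    rw [← integral_add (integrable_smul_of_test a hψ hc) (integrable_smul_of_test b hψ hc)]
    refine integral_congr_ae ?_
    filter_upwards [Lp.coeFn_add a b] with y hy
    rw [hy, Pi.add_apply, smul_add]
  rw [key _ _ _ (h1.continuous_deriv (by simp)) h2.deriv, key _ _ _ h1.continuous h2,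
    hg φ h1 h2 h3, hh φ h1 h2 h3]
  ring

lemma IsWeakDeriv.smul {Ω : Opens ℝ} {g g₁ : X Ω} (c : ℂ) (hg : IsWeakDeriv Ω g g₁) :
    IsWeakDeriv Ω (c • g) (c • g₁) := by
  intro φ h1 h2 h3
  have key : ∀ (a : X Ω) (ψ : ℝ → ℝ),
      ∫ y in (Ω : Set ℝ), ψ y • (c • a : X Ω) y = c • ∫ y in (Ω : Set ℝ), ψ y • a y := by
    intro a ψ
    rw [← integral_smul]
    refine integral_congr_ae ?_
    filter_upwards [Lp.coeFn_smul c a] with y hy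
    rw [hy, Pi.smul_apply, smul_comm]
  rw [key, key, hg φ h1 h2 h3, smul_neg]

lemma isWeakDeriv_zero (Ω : Opens ℝ) : IsWeakDeriv Ω 0 0 := by
  intro φ _ _ _
  have key : ∀ ψ : ℝ → ℝ, ∫ y in (Ω : Set ℝ), ψ y • (0 : X Ω) y = 0 := by
    intro ψ
    rw [← integral_zero ℝ ℂ (μ := volume.restrict (Ω : Set ℝ))]
    refine integral_congr_ae ?_
    filter_upwards [Lp.coeFn_zero ℂ 2 (volume.restrict (Ω : Set ℝ))] with y hy
    rw [hy, Pi.zero_apply, smul_zero]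
  rw [key, key, neg_zero]

lemma IsWeakDeriv.unique {Ω : Opens ℝ} {g a b : X Ω} (ha : IsWeakDeriv Ω g a)
    (hb : IsWeakDeriv Ω g b) : a = b := by
  have hlint : LocallyIntegrableOn (a - b : X Ω) (Ω : Set ℝ) volume :=
    locallyIntegrableOn_of_locallyIntegrable_restrict
      ((Lp.memLp (a - b)).locallyIntegrable (by norm_num))
  have h0 := Ω.isOpen.ae_eq_zero_of_integral_contDiff_smul_eq_zero hlint (by
    intro φ h1 h2 h3
    rw [← setIntegral_eq_integral_of_forall_compl_eq_zero (s := (Ω : Set ℝ))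
      (fun y hy => by rw [image_eq_zero_of_notMem_tsupport (fun h => hy (h3 h)), zero_smul])]
    have e : ∫ y in (Ω : Set ℝ), φ y • (a - b : X Ω) y
        = (∫ y in (Ω : Set ℝ), φ y • a y) - ∫ y in (Ω : Set ℝ), φ y • b y := by
      rw [← integral_sub (integrable_smul_of_test a h1.continuous h2)
        (integrable_smul_of_test b h1.continuous h2)]
      refine integral_congr_ae ?_
      filter_upwards [Lp.coeFn_sub a b] with y hy
      rw [hy, Pi.sub_apply, smul_sub]
    have := (ha φ h1 h2 h3).symm.trans (hb φ h1 h2 h3)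
    rw [e, neg_inj.1 this, sub_self])
  refine sub_eq_zero.1 (Lp.ext ?_)
  filter_upwards [(ae_restrict_iff' Ω.isOpen.measurableSet).2 h0,
    Lp.coeFn_zero ℂ 2 (volume.restrict (Ω : Set ℝ))] with y h1 h2
  rw [h1, h2, Pi.zero_apply]

lemma HasZeroTrace.add {Ω : Opens ℝ} {a b : X Ω} (ha : HasZeroTrace Ω a)
    (hb : HasZeroTrace Ω b) : HasZeroTrace Ω (a + b) := by
  obtain ⟨u, hu, hu', hu0⟩ := ha
  obtain ⟨w, hw, hw', hw0⟩ := hb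
  refine ⟨u + w, hu.add hw, ?_, fun y hy => by simp [hu0 y hy, hw0 y hy]⟩
  filter_upwards [Lp.coeFn_add a b, hu', hw'] with y h1 h2 h3
  rw [h1, Pi.add_apply, Pi.add_apply, h2, h3]

lemma HasZeroTrace.smul {Ω : Opens ℝ} {a : X Ω} (c : ℂ) (ha : HasZeroTrace Ω a) :
    HasZeroTrace Ω (c • a) := by
  obtain ⟨u, hu, hu', hu0⟩ := ha
  refine ⟨c • u, hu.const_smul c, ?_, fun y hy => by simp [hu0 y hy]⟩
  filter_upwards [Lp.coeFn_smul c a, hu'] with y h1 h2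
  rw [h1, Pi.smul_apply, Pi.smul_apply, h2]

lemma hasZeroTrace_zero (Ω : Opens ℝ) : HasZeroTrace Ω 0 := by
  refine ⟨0, continuousOn_const, ?_, fun y _ => rfl⟩
  filter_upwards [Lp.coeFn_zero ℂ 2 (volume.restrict (Ω : Set ℝ))] with y hy
  rw [hy]

/-- `g` belongs to `H²(Ω)` and satisfies the homogeneous Neumann condition, with second weak
derivative `g₂`. -/
def IsNeumannSecondDeriv (Ω : Opens ℝ) (g g₂ : X Ω) : Prop :=
  ∃ g₁ : X Ω, IsWeakDeriv Ω g g₁ ∧ HasZeroTrace Ω g₁ ∧ IsWeakDeriv Ω g₁ g₂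

lemma IsNeumannSecondDeriv.add {Ω : Opens ℝ} {g g₂ h h₂ : X Ω}
    (hg : IsNeumannSecondDeriv Ω g g₂) (hh : IsNeumannSecondDeriv Ω h h₂) :
    IsNeumannSecondDeriv Ω (g + h) (g₂ + h₂) := by
  obtain ⟨a, a1, a2, a3⟩ := hg
  obtain ⟨b, b1, b2, b3⟩ := hh
  exact ⟨a + b, a1.add b1, a2.add b2, a3.add b3⟩

lemma IsNeumannSecondDeriv.smul {Ω : Opens ℝ} {g g₂ : X Ω} (c : ℂ)
    (hg : IsNeumannSecondDeriv Ω g g₂) : IsNeumannSecondDeriv Ω (c • g) (c • g₂) := by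
  obtain ⟨a, a1, a2, a3⟩ := hg
  exact ⟨c • a, a1.smul c, a2.smul c, a3.smul c⟩

lemma IsNeumannSecondDeriv.unique {Ω : Opens ℝ} {g a b : X Ω}
    (ha : IsNeumannSecondDeriv Ω g a) (hb : IsNeumannSecondDeriv Ω g b) : a = b := by
  obtain ⟨p, p1, _, p3⟩ := ha
  obtain ⟨q, q1, _, q3⟩ := hb
  obtain rfl := p1.unique q1
  exact p3.unique q3

/-- The functions `g ∈ H²(Ω)` with `g' = 0` on `∂Ω` for which moreover `v g ∈ L²(Ω)`, so that
`-ν g'' + i k v g` lies in `L²(Ω)`. The last requirement is automatic for bounded `v`. -/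
def neumannDomain (Ω : Opens ℝ) (v : ℝ → ℝ) : Submodule ℂ (X Ω) where
  carrier := {g | (∃ g₂ : X Ω, IsNeumannSecondDeriv Ω g g₂) ∧
    MemLp (fun y => (v y : ℂ) * g y) 2 (volume.restrict (Ω : Set ℝ))}
  add_mem' := by
    rintro g h ⟨⟨a, ha⟩, hg⟩ ⟨⟨b, hb⟩, hh⟩
    refine ⟨⟨a + b, ha.add hb⟩, (memLp_congr_ae ?_).2 (hg.add hh)⟩
    filter_upwards [Lp.coeFn_add g h] with y hy
    exact (congrArg (fun t => (v y : ℂ) * t) hy).trans (mul_add _ _ _)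
  zero_mem' := by
    refine ⟨⟨0, 0, isWeakDeriv_zero Ω, hasZeroTrace_zero Ω, isWeakDeriv_zero Ω⟩,
      (memLp_congr_ae ?_).2 (MemLp.zero (ε := ℂ))⟩
    filter_upwards [Lp.coeFn_zero ℂ 2 (volume.restrict (Ω : Set ℝ))] with y hy
    exact (congrArg (fun t => (v y : ℂ) * t) hy).trans (mul_zero _)
  smul_mem' := by
    rintro c g ⟨⟨a, ha⟩, hg⟩
    refine ⟨⟨c • a, ha.smul c⟩, (memLp_congr_ae ?_).2 (hg.const_smul c)⟩
    filter_upwards [Lp.coeFn_smul c g] with y hy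
    exact (congrArg (fun t => (v y : ℂ) * t) hy).trans (mul_left_comm _ _ _)

/-- The second weak derivative `g''` of an element of `neumannDomain`. -/
def secondDeriv {Ω : Opens ℝ} {v : ℝ → ℝ} (g : neumannDomain Ω v) : X Ω := g.2.1.choose

lemma secondDeriv_spec {Ω : Opens ℝ} {v : ℝ → ℝ} (g : neumannDomain Ω v) :
    IsNeumannSecondDeriv Ω g (secondDeriv g) := g.2.1.choose_spec

/-- The product `v g`, as an element of `L²(Ω)`. -/
def mulV {Ω : Opens ℝ} {v : ℝ → ℝ} (g : neumannDomain Ω v) : X Ω := g.2.2.toLp _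

lemma mulV_spec {Ω : Opens ℝ} {v : ℝ → ℝ} (g : neumannDomain Ω v) :
    ∀ᵐ y ∂(volume.restrict (Ω : Set ℝ)), mulV g y = (v y : ℂ) * (g : X Ω) y :=
  g.2.2.coeFn_toLp

/-- The differential operator `-ν ∂_y² + i k v(y)` with Neumann conditions, on `neumannDomain`. -/
def operatorCore (Ω : Opens ℝ) (v : ℝ → ℝ) (ν k : ℝ) : X Ω →ₗ.[ℂ] X Ω where
  domain := neumannDomain Ω v
  toFun :=
    { toFun := fun g => -((ν : ℂ) • secondDeriv g) + (Complex.I * (k : ℂ)) • mulV g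
      map_add' := by
        intro g h
        have h1 : secondDeriv (g + h) = secondDeriv g + secondDeriv h :=
          (secondDeriv_spec (g + h)).unique ((secondDeriv_spec g).add (secondDeriv_spec h))
        have h2 : mulV (g + h) = mulV g + mulV h := by
          refine Lp.ext ?_
          filter_upwards [mulV_spec (g + h), mulV_spec g, mulV_spec h,
            Lp.coeFn_add (mulV g) (mulV h), Lp.coeFn_add (g : X Ω) (h : X Ω)] with y a b c d e
          rw [a, d, Pi.add_apply, b, c, Submodule.coe_add, e, Pi.add_apply, mul_add]
        rw [h1, h2, smul_add, smul_add]
        abel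
      map_smul' := by
        intro c g
        have h1 : secondDeriv (c • g) = c • secondDeriv g :=
          (secondDeriv_spec (c • g)).unique ((secondDeriv_spec g).smul c)
        have h2 : mulV (c • g) = c • mulV g := by
          refine Lp.ext ?_
          filter_upwards [mulV_spec (c • g), mulV_spec g,
            Lp.coeFn_smul c (mulV g), Lp.coeFn_smul c (g : X Ω)] with y a b d e
          rw [a, d, Pi.smul_apply, b, Submodule.coe_smul, e, Pi.smul_apply, smul_eq_mul,
            smul_eq_mul, mul_left_comm]
        rw [h1, h2, smul_comm, smul_comm _ c, RingHom.id_apply, smul_add, smul_neg] }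

/-- The operator `H_{ν,k} = -ν ∂_y² + i k v(y)` on `L²(Ω)`: the closure of the differential
operator on `neumannDomain`. (A closed operator is its own closure; for `v` growing very
irregularly, the operator on `neumannDomain` is only closable.) -/
def H (Ω : Opens ℝ) (v : ℝ → ℝ) (ν k : ℝ) : X Ω →ₗ.[ℂ] X Ω :=
  (operatorCore Ω v ν k).closure

section Resolvent

variable {E : Type*} [NormedAddCommGroup E] [NormedSpace ℂ E]

/-- The bounded operator `R` is the inverse `(A - z)⁻¹` of `A - z : D(A) → E`. -/
def IsResolvent (A : E →ₗ.[ℂ] E) (z : ℂ) (R : E →L[ℂ] E) : Prop :=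
  (∀ f : E, ∃ h : R f ∈ A.domain, A ⟨R f, h⟩ - z • R f = f) ∧
    ∀ g : A.domain, R (A g - z • (g : E)) = g

/-- `‖(A - z)⁻¹‖ ∈ [0, ∞]`, equal to `∞` when `A - z` has no bounded everywhere defined inverse,
that is, when `z` is in the spectrum of `A`. (The resolvent is unique if it exists.) -/
def resolventNorm (A : E →ₗ.[ℂ] E) (z : ℂ) : ℝ≥0∞ :=
  ⨅ (R : E →L[ℂ] E) (_ : IsResolvent A z R), ‖R‖ₑ

/-- The pseudospectral abscissa `Ψ(A) = (sup_{z ∈ iℝ} ‖(A - z)⁻¹‖)⁻¹`. -/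
def pseudospectralAbscissa (A : E →ₗ.[ℂ] E) : ℝ≥0∞ :=
  (⨆ s : ℝ, resolventNorm A ((s : ℂ) * Complex.I))⁻¹

end Resolvent

/-- The decay rate `λ_{ν,k}`. -/
def rate (m : ℕ) (ν k : ℝ) : ℝ :=
  if ν ≤ |k| then ν ^ ((m : ℝ) / (m + 2)) * |k| ^ ((2 : ℝ) / (m + 2)) else k ^ 2 / ν

end ShearFlow

end

/-!
The abscissa is bounded below by estimating `‖(H - i s) g‖` from below, uniformly in the real
number `s`, on restrictions of smooth compactly supported functions satisfying the Neumann
condition.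

The nondegeneracy of `v` says that some derivative of order at most `m` is bounded away from zero
near every point, uniformly because `|v'|` is bounded below at infinity. Integrating that derivative
down, discarding three quarters of the interval each time, one finds in every interval of length
`δ ≤ 1` a proportional subinterval on which `v - σ` has a constant sign and `|v - σ| ≳ δ ^ m`,
whatever the level `σ`.

Testing `(H - i s) g` with `g` itself controls `ν ‖g'‖²`. Testing it with `g` times a cutoff
supported in such a subinterval controls `|k| δ ^ m` times the minimum of `|g|²` there, and moving
away from the minimum over a distance `δ` costs `δ² ‖g'‖²`. Summing over intervals of length `δ`
filling the support of `g`, and choosing `δ` so that diffusion and mixing balance, `ν / δ²`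
being comparable to `|k| δ ^ m`, gives the rate.

To turn this into a resolvent bound for the closure one needs that the range of `H - i s` on these
functions is dense and that the closure has no eigenvalue `i s`. Both reduce to uniqueness of
weak `L²` solutions of `f'' = i Q f` with real `Q`: reflection across the endpoint moves the problem
to the whole line, where `Re (f'' conj f) = 0` makes `|f|²` convex, hence zero because it is
integrable.
-/

noncomputable section

namespace ShearFlow

section Geometry

/-- `f` has a constant sign and absolute value at least `η` on `s`; the sign is recorded by a
number `ε` of absolute value one. -/
def HasSignedLowerBound (f : ℝ → ℝ) (η : ℝ) (s : Set ℝ) : Prop :=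
  ∃ ε : ℝ, |ε| = 1 ∧ ∀ x ∈ s, η ≤ ε * f x

/-- `f` has a signed lower bound `η` on some compact interval of length `L` contained in `I`. -/
def HasSignedSubinterval (f : ℝ → ℝ) (η L : ℝ) (I : Set ℝ) : Prop :=
  ∃ p, Icc p (p + L) ⊆ I ∧ HasSignedLowerBound f η (Icc p (p + L))

lemma HasSignedLowerBound.mono {f : ℝ → ℝ} {η η' : ℝ} {s t : Set ℝ}
    (h : HasSignedLowerBound f η s) (hη : η' ≤ η) (hts : t ⊆ s) : HasSignedLowerBound f η' t :=
  let ⟨ε, hε, hf⟩ := h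
  ⟨ε, hε, fun x hx => hη.trans (hf x (hts hx))⟩

lemma HasSignedLowerBound.const_mul {f : ℝ → ℝ} {η k : ℝ} {s : Set ℝ}
    (h : HasSignedLowerBound f η s) (hk : k ≠ 0) :
    HasSignedLowerBound (fun x => k * f x) (|k| * η) s := by
  obtain ⟨ε, hε, hf⟩ := h
  have hk' : |k| ≠ 0 := abs_ne_zero.2 hk
  refine ⟨ε * (|k| / k), by rw [abs_mul, hε, abs_div, abs_abs, div_self hk', one_mul],
    fun x hx => ?_⟩
  calc |k| * η ≤ |k| * (ε * f x) := by gcongr; exact hf x hx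
    _ = ε * (|k| / k) * (k * f x) := by field_simp

lemma hasSignedLowerBound_of_isPreconnected {f : ℝ → ℝ} {η : ℝ} {s : Set ℝ}
    (hs : IsPreconnected s) (hf : ContinuousOn f s) (hη : 0 < η) (h : ∀ x ∈ s, η ≤ |f x|) :
    HasSignedLowerBound f η s := by
  have hsq : EqOn (f ^ 2) ((fun x => |f x|) ^ 2) s := fun x _ => by simp [sq_abs]
  rcases hs.eq_or_eq_neg_of_sq_eq hf hf.abs hsq
    (fun {x} hx => (hη.trans_le (h x hx)).ne') with heq | heq
  · exact ⟨1, abs_one, fun x hx => by rw [one_mul, heq hx]; exact h x hx⟩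
  · exact ⟨-1, by simp, fun x hx => by
      rw [heq hx, Pi.neg_apply, neg_one_mul, neg_neg]; exact h x hx⟩

lemma HasSignedSubinterval.mono {f : ℝ → ℝ} {η η' L L' : ℝ} {I J : Set ℝ}
    (h : HasSignedSubinterval f η L I) (hη : η' ≤ η) (hL : L' ≤ L) (hIJ : I ⊆ J) :
    HasSignedSubinterval f η' L' J := by
  obtain ⟨p, hp, hf⟩ := h
  have hsub : Icc p (p + L') ⊆ Icc p (p + L) := Icc_subset_Icc_right (by linarith)
  exact ⟨p, (hsub.trans hp).trans hIJ, hf.mono hη hsub⟩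

lemma HasSignedSubinterval.const_mul {f : ℝ → ℝ} {η L k : ℝ} {I : Set ℝ}
    (h : HasSignedSubinterval f η L I) (hk : k ≠ 0) :
    HasSignedSubinterval (fun x => k * f x) (|k| * η) L I :=
  let ⟨p, hp, hf⟩ := h
  ⟨p, hp, hf.const_mul hk⟩

lemma HasSignedLowerBound.hasSignedSubinterval_of_deriv {u u' : ℝ → ℝ} {a L h : ℝ} (hL : 0 ≤ L)
    (hh : 0 ≤ h) (hc : ContinuousOn u (Icc a (a + L)))
    (hd : ∀ x ∈ Ioo a (a + L), HasDerivAt u (u' x) x)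
    (hu' : HasSignedLowerBound u' h (Icc a (a + L))) :
    HasSignedSubinterval u (h * (L / 4)) (L / 4) (Icc a (a + L)) := by
  obtain ⟨ε, hε, hεu'⟩ := hu'
  have growth : ∀ x ∈ Icc a (a + L), ∀ y ∈ Icc a (a + L), x ≤ y →
      h * (y - x) ≤ ε * u y - ε * u x := by
    have hd' : ∀ x ∈ interior (Icc a (a + L)), HasDerivAt (fun x => ε * u x) (ε * u' x) x :=
      fun x hx => (hd x (interior_Icc (α := ℝ) ▸ hx)).const_mul ε
    refine (convex_Icc a (a + L)).mul_sub_le_image_sub_of_le_deriv (hc.const_mul ε)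
      (fun x hx => (hd' x hx).differentiableAt.differentiableWithinAt) fun x hx => ?_
    rw [(hd' x hx).deriv]
    exact hεu' x (interior_subset hx)
  have hmid : a + L / 2 ∈ Icc a (a + L) := ⟨by linarith, by linarith⟩
  rcases le_total 0 (ε * u (a + L / 2)) with hpos | hneg
  · have hsub : Icc (a + 3 * L / 4) (a + 3 * L / 4 + L / 4) ⊆ Icc a (a + L) :=
      Icc_subset_Icc (by linarith) (by linarith)
    refine ⟨a + 3 * L / 4, hsub, ε, hε, fun x hx => ?_⟩
    calc h * (L / 4) ≤ h * (x - (a + L / 2)) := by gcongr; linarith [hx.1]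
      _ ≤ ε * u x - ε * u (a + L / 2) := growth _ hmid x (hsub hx) (by linarith [hx.1])
      _ ≤ ε * u x := by linarith
  · have hsub : Icc a (a + L / 4) ⊆ Icc a (a + L) := Icc_subset_Icc_right (by linarith)
    refine ⟨a, hsub, -ε, by rwa [abs_neg], fun x hx => ?_⟩
    calc h * (L / 4) ≤ h * ((a + L / 2) - x) := by gcongr; linarith [hx.2]
      _ ≤ ε * u (a + L / 2) - ε * u x := growth x (hsub hx) _ hmid (by linarith [hx.2])
      _ ≤ -ε * u x := by linarith

lemma hasSignedSubinterval_of_iterated_deriv {U : ℕ → ℝ → ℝ} {h : ℝ} (hh : 0 ≤ h) (j : ℕ)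
    {a L : ℝ} (hL : 0 ≤ L) (hc : ∀ i < j, ContinuousOn (U i) (Icc a (a + L)))
    (hd : ∀ i < j, ∀ x ∈ Ioo a (a + L), HasDerivAt (U i) (U (i + 1) x) x)
    (hU : HasSignedLowerBound (U j) h (Icc a (a + L))) :
    HasSignedSubinterval (U 0) (h * (L / 4 ^ j) ^ j) (L / 4 ^ j) (Icc a (a + L)) := by
  induction j generalizing a L h with
  | zero => exact ⟨a, by simp, by simpa using hU⟩
  | succ j ih =>
    obtain ⟨p, hp, hUj⟩ := hU.hasSignedSubinterval_of_deriv hL hh (hc j j.lt_succ_self)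
      (hd j j.lt_succ_self)
    obtain ⟨hap, hpa⟩ := (Icc_subset_Icc_iff (by linarith)).1 hp
    have hquarter : L / 4 / 4 ^ j = L / 4 ^ (j + 1) := by rw [pow_succ]; field_simp
    have hsub := ih (by positivity) (by positivity) (fun i hi => (hc i (by lia)).mono hp)
      (fun i hi x hx => hd i (by lia) x (Ioo_subset_Ioo hap hpa hx)) hUj
    refine hsub.mono ?_ hquarter.ge hp
    rw [hquarter, pow_succ' (L / 4 ^ (j + 1)), ← mul_assoc]
    gcongr
    exact le_self_pow₀ (by norm_num) (by lia)

end Geometry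

section Nondegeneracy

lemma exists_forall_le_norm_of_isCompact {α ι E : Type*} [PseudoMetricSpace α] [Finite ι]
    [NormedAddCommGroup E] {K : Set α} (hK : IsCompact K) {F : α → ι → E} (hF : ContinuousOn F K)
    (hF0 : ∀ x ∈ K, F x ≠ 0) :
    ∃ d > 0, ∃ c > 0, ∀ x ∈ K, ∃ j, ∀ y ∈ K, dist y x < d → c ≤ ‖F y j‖ := by
  have := Fintype.ofFinite ι
  obtain ⟨s, hs, hsF⟩ := hK.exists_forall_le' hF.norm fun x hx => norm_pos_iff.2 (hF0 x hx)
  obtain ⟨d, hd, hdF⟩ := Metric.uniformContinuousOn_iff.1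
    (hK.uniformContinuousOn_of_continuous hF) (s / 2) (half_pos hs)
  refine ⟨d, hd, s / 2, half_pos hs, fun x hx => ?_⟩
  obtain ⟨j, hj⟩ : ∃ j, s ≤ ‖F x j‖ := by
    by_contra! hlt
    exact (hsF x hx).not_gt ((pi_norm_lt_iff hs).2 hlt)
  refine ⟨j, fun y hy hyx => ?_⟩
  have hclose : ‖F y j - F x j‖ < s / 2 := by
    rw [← dist_eq_norm]
    exact (dist_le_pi_dist _ _ j).trans_lt (hdF y hy x hx hyx)
  linarith [norm_sub_norm_le (F x j) (F y j), norm_sub_rev (F x j) (F y j)]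

lemma exists_forall_norm_gt_of_le_liminf {E : Type*} [NormedAddCommGroup E] [ProperSpace E]
    {f : E → ℝ} {S : Set E} {b c : ℝ} (hc : 0 < c) (hbc : b < c)
    (h : ENNReal.ofReal c ≤ liminf (fun y => ENNReal.ofReal (f y)) (cocompact E ⊓ 𝓟 S)) :
    ∃ R, ∀ y ∈ S, R < ‖y‖ → b < f y := by
  have hev := eventually_lt_of_lt_liminf
    (((ENNReal.ofReal_lt_ofReal_iff hc).2 hbc).trans_le h)
  rw [eventually_inf_principal, ← Metric.cobounded_eq_cocompact,
    (Metric.hasBasis_cobounded_compl_closedBall (0 : E)).eventually_iff] at hev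
  obtain ⟨R, -, hR⟩ := hev
  refine ⟨R, fun y hy hRy => (ENNReal.ofReal_lt_ofReal_iff'.1 (hR ?_ hy)).1⟩
  simpa using hRy

lemma exists_iteratedDerivWithin_ne_zero {m : ℕ} {S : Set ℝ} {v : ℝ → ℝ} {y : ℝ}
    (h : 0 < ∑ j ∈ Finset.Icc 1 m, |iteratedDerivWithin j v S y|) :
    ∃ j : Fin m, iteratedDerivWithin (j + 1) v S y ≠ 0 := by
  obtain ⟨j, hj, hjy⟩ := Finset.exists_ne_zero_of_sum_ne_zero h.ne'
  obtain ⟨hj1, hjm⟩ := Finset.mem_Icc.1 hj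
  exact ⟨⟨j - 1, by lia⟩, by simpa [Nat.sub_add_cancel hj1] using hjy⟩

/-- `v` leaves each of its levels `σ` at order `m`: on a proportion `l` of any interval of length
`δ ≤ 1` in `S`, the difference `v - σ` keeps its sign and has size at least `c δ ^ m`. -/
def LeavesLevels (v : ℝ → ℝ) (S : Set ℝ) (m : ℕ) (l c : ℝ) : Prop :=
  ∀ a δ σ : ℝ, 0 < δ → δ ≤ 1 → Icc a (a + δ) ⊆ S →
    HasSignedSubinterval (fun x => v x - σ) (c * δ ^ m) (l * δ) (Icc a (a + δ))

variable {m : ℕ} {S : Set ℝ} {v : ℝ → ℝ}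

lemma exists_uniform_nondegeneracy (hS : UniqueDiffOn ℝ S) (hcl : IsClosed S)
    (hv : ContDiffOn ℝ m v S)
    (hnondeg : ∀ y ∈ S, 0 < ∑ j ∈ Finset.Icc 1 m, |iteratedDerivWithin j v S y|)
    {c₀ : ℝ} (hc₀ : 0 < c₀) (hinfty : ENNReal.ofReal c₀ ≤
      liminf (fun y => ENNReal.ofReal |derivWithin v S y|) (cocompact ℝ ⊓ 𝓟 S)) :
    ∃ r c : ℝ, 0 < r ∧ r ≤ 1 ∧ 0 < c ∧ ∀ a δ : ℝ, 0 < δ → δ ≤ r → Icc a (a + δ) ⊆ S →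
      ∃ j ≤ m, j ≠ 0 ∧ ∀ x ∈ Icc a (a + δ), c ≤ |iteratedDerivWithin j v S x| := by
  obtain ⟨R, hR⟩ := exists_forall_norm_gt_of_le_liminf hc₀ (half_lt_self hc₀) hinfty
  have hcont : ContinuousOn (fun y => fun j : Fin m => iteratedDerivWithin (j + 1) v S y) S :=
    continuousOn_pi.2 fun j => hv.continuousOn_iteratedDerivWithin (by exact_mod_cast j.2) hS
  obtain ⟨d, hd, c, hc, hdc⟩ := exists_forall_le_norm_of_isCompact
    ((isCompact_Icc (a := -(R + 2)) (b := R + 2)).inter_left hcl) (hcont.mono inter_subset_left)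
    fun y hy h0 => let ⟨j, hj⟩ := exists_iteratedDerivWithin_ne_zero (hnondeg y hy.1)
      hj (congrFun h0 j)
  refine ⟨min (d / 2) 1, min c (c₀ / 2), by positivity, min_le_right _ _, by positivity,
    fun a δ hδ hδr hsub => ?_⟩
  obtain ⟨hδd, hδ1⟩ := le_min_iff.1 hδr
  by_cases ha : |a| ≤ R + 1
  · obtain ⟨ha1, ha2⟩ := abs_le.1 ha
    have hmem : ∀ x ∈ Icc a (a + δ), x ∈ S ∩ Icc (-(R + 2)) (R + 2) := fun x hx =>
      ⟨hsub hx, by linarith [hx.1], by linarith [hx.2]⟩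
    obtain ⟨j, hj⟩ := hdc a (hmem a ⟨le_rfl, by linarith⟩)
    refine ⟨j + 1, j.2, j.val.succ_ne_zero, fun x hx => (min_le_left _ _).trans ?_⟩
    refine hj x (hmem x hx) ?_
    rw [Real.dist_eq, abs_of_nonneg (by linarith [hx.1])]
    linarith [hx.2]
  · have hm : m ≠ 0 := by
      rintro rfl
      simpa using hnondeg a (hsub ⟨le_rfl, by linarith⟩)
    refine ⟨1, Nat.one_le_iff_ne_zero.2 hm, one_ne_zero, fun x hx => (min_le_right _ _).trans ?_⟩
    rw [iteratedDerivWithin_one]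
    refine (hR x (hsub hx) ?_).le
    have hax : |a - x| ≤ 1 := abs_le.2 ⟨by linarith [hx.2], by linarith [hx.1]⟩
    rw [Real.norm_eq_abs]
    linarith [abs_sub_abs_le_abs_sub a x]

lemma hasSignedSubinterval_of_le_abs_iteratedDerivWithin (hS : UniqueDiffOn ℝ S)
    (hv : ContDiffOn ℝ m v S) {a L c : ℝ} (hL : 0 ≤ L) (hc : 0 < c) (hsub : Icc a (a + L) ⊆ S)
    {j : ℕ} (hjm : j ≤ m) (hj0 : j ≠ 0)
    (hj : ∀ x ∈ Icc a (a + L), c ≤ |iteratedDerivWithin j v S x|) (σ : ℝ) :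
    HasSignedSubinterval (fun x => v x - σ) (c * (L / 4 ^ j) ^ j) (L / 4 ^ j)
      (Icc a (a + L)) := by
  let U : ℕ → ℝ → ℝ := fun i x => iteratedDerivWithin i v S x - if i = 0 then σ else 0
  have hU0 : U 0 = fun x => v x - σ := by ext x; simp [U]
  have hUj : U j = iteratedDerivWithin j v S := by ext x; simp [U, hj0]
  have hcont : ∀ i ≤ m, ContinuousOn (U i) (Icc a (a + L)) := fun i hi =>
    ((hv.continuousOn_iteratedDerivWithin (by exact_mod_cast hi) hS).mono hsub).sub
      continuousOn_const
  rw [← hU0]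
  refine hasSignedSubinterval_of_iterated_deriv hc.le j hL (fun i hi => hcont i (by lia))
    (fun i hi x hx => ?_)
    (hasSignedLowerBound_of_isPreconnected isPreconnected_Icc (hcont j hjm) hc (by rwa [hUj]))
  have hxS : S ∈ 𝓝 x := mem_of_superset (Icc_mem_nhds hx.1 hx.2) hsub
  have hderiv : HasDerivAt (iteratedDerivWithin i v S) (iteratedDerivWithin (i + 1) v S x) x := by
    rw [iteratedDerivWithin_succ]
    exact (hv.differentiableOn_iteratedDerivWithin (by exact_mod_cast hi.trans_le hjm) hS x
      (mem_of_mem_nhds hxS)).hasDerivWithinAt.hasDerivAt hxS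
  simpa [U] using hderiv.sub_const (if i = 0 then σ else 0)

lemma exists_leavesLevels (hS : UniqueDiffOn ℝ S) (hcl : IsClosed S) (hv : ContDiffOn ℝ m v S)
    (hnondeg : ∀ y ∈ S, 0 < ∑ j ∈ Finset.Icc 1 m, |iteratedDerivWithin j v S y|)
    {c₀ : ℝ} (hc₀ : 0 < c₀) (hinfty : ENNReal.ofReal c₀ ≤
      liminf (fun y => ENNReal.ofReal |derivWithin v S y|) (cocompact ℝ ⊓ 𝓟 S)) :
    ∃ l c : ℝ, 0 < l ∧ 0 < c ∧ LeavesLevels v S m l c := by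
  obtain ⟨r, c, hr, hr1, hc, hrc⟩ := exists_uniform_nondegeneracy hS hcl hv hnondeg hc₀ hinfty
  refine ⟨r / 4 ^ m, c * (r / 4 ^ m) ^ m, by positivity, by positivity,
    fun a δ σ hδ hδ1 hsub => ?_⟩
  have hrδ : r * δ ≤ δ := mul_le_of_le_one_left hδ.le hr1
  have hIcc : Icc a (a + r * δ) ⊆ Icc a (a + δ) := Icc_subset_Icc_right (by linarith)
  obtain ⟨j, hjm, hj0, hj⟩ := hrc a (r * δ) (by positivity)
    (mul_le_of_le_one_right hr.le hδ1) (hIcc.trans hsub)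
  have hlen : r / 4 ^ m * δ ≤ r * δ / 4 ^ j := by
    rw [div_mul_eq_mul_div]
    gcongr
    norm_num
  have hlen1 : r * δ / 4 ^ j ≤ 1 :=
    (div_le_self (by positivity) (one_le_pow₀ (by norm_num))).trans (hrδ.trans hδ1)
  refine (hasSignedSubinterval_of_le_abs_iteratedDerivWithin hS hv (by positivity) hc
    (hIcc.trans hsub) hjm hj0 hj σ).mono ?_ hlen hIcc
  calc c * (r / 4 ^ m) ^ m * δ ^ m = c * (r / 4 ^ m * δ) ^ m := by ring
    _ ≤ c * (r * δ / 4 ^ j) ^ m := by gcongr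
    _ ≤ c * (r * δ / 4 ^ j) ^ j := by
      gcongr ?_ * ?_
      exact pow_le_pow_of_le_one (by positivity) hlen1 hjm

end Nondegeneracy

section LocalEstimate

open ComplexConjugate intervalIntegral

lemma integral_norm_mul_norm_le_sqrt_mul_sqrt {α E F : Type*} [MeasurableSpace α] {μ : Measure α}
    [NormedAddCommGroup E] [NormedAddCommGroup F] {f : α → E} {g : α → F} (hf : MemLp f 2 μ)
    (hg : MemLp g 2 μ) :
    ∫ x, ‖f x‖ * ‖g x‖ ∂μ ≤ √(∫ x, ‖f x‖ ^ 2 ∂μ) * √(∫ x, ‖g x‖ ^ 2 ∂μ) := by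
  simpa [Real.sqrt_eq_rpow] using integral_mul_norm_le_Lp_mul_Lq Real.HolderConjugate.two_two
    (f := fun x => ‖f x‖) (g := fun x => ‖g x‖) (by simpa using hf.norm) (by simpa using hg.norm)

lemma memLp_two_restrict_Icc_of_continuousOn {E : Type*} [NormedAddCommGroup E] {f : ℝ → E}
    {a b : ℝ} (hf : ContinuousOn f (Icc a b)) : MemLp f 2 (volume.restrict (Icc a b)) :=
  (memLp_two_iff_integrable_sq_norm
    (hf.aestronglyMeasurable_of_isCompact isCompact_Icc measurableSet_Icc)).2
    (hf.norm.pow 2).integrableOn_Icc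

lemma intervalIntegral_norm_mul_norm_le_sqrt_mul_sqrt {E F : Type*} [NormedAddCommGroup E]
    [NormedAddCommGroup F] {f : ℝ → E} {g : ℝ → F} {a b : ℝ} (hab : a ≤ b)
    (hf : ContinuousOn f (Icc a b)) (hg : ContinuousOn g (Icc a b)) :
    ∫ x in a..b, ‖f x‖ * ‖g x‖ ≤
      √(∫ x in a..b, ‖f x‖ ^ 2) * √(∫ x in a..b, ‖g x‖ ^ 2) := by
  simp only [integral_of_le hab, ← integral_Icc_eq_integral_Ioc]
  exact integral_norm_mul_norm_le_sqrt_mul_sqrt (memLp_two_restrict_Icc_of_continuousOn hf)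
    (memLp_two_restrict_Icc_of_continuousOn hg)

lemma norm_sq_le_two_mul_add_integral_deriv {E : Type*} [NormedAddCommGroup E] [NormedSpace ℝ E]
    [CompleteSpace E] {G : ℝ → E} (hG : ContDiff ℝ 1 G) {a b x y : ℝ} (hx : x ∈ Icc a b)
    (hy : y ∈ Icc a b) :
    ‖G x‖ ^ 2 ≤ 2 * ‖G y‖ ^ 2 + 2 * (b - a) * ∫ t in a..b, ‖deriv G t‖ ^ 2 := by
  have hab : a ≤ b := hx.1.trans hx.2
  have cG' : Continuous (deriv G) := hG.continuous_deriv_one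
  have hosc : ‖G x - G y‖ ≤ ∫ t in a..b, ‖deriv G t‖ := by
    rw [← integral_deriv_eq_sub' G rfl (fun t _ => (hG.differentiable one_ne_zero) t)
      cG'.continuousOn]
    calc ‖∫ t in y..x, deriv G t‖ ≤ |∫ t in y..x, ‖deriv G t‖| := norm_integral_le_abs_integral_norm
      _ ≤ |∫ t in a..b, ‖deriv G t‖| := by
        refine abs_integral_mono_interval ?_ (ae_of_all _ fun t => norm_nonneg _)
          (cG'.norm.intervalIntegrable _ _)
        rw [uIoc_of_le hab]
        exact Ioc_subset_Ioc (le_min hy.1 hx.1) (max_le hy.2 hx.2)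
      _ = ∫ t in a..b, ‖deriv G t‖ := abs_of_nonneg (integral_nonneg hab fun t _ => norm_nonneg _)
  have hcs : ∫ t in a..b, ‖deriv G t‖ ≤ √(b - a) * √(∫ t in a..b, ‖deriv G t‖ ^ 2) := by
    simpa using intervalIntegral_norm_mul_norm_le_sqrt_mul_sqrt (f := fun _ => (1 : ℝ)) hab
      continuousOn_const cG'.continuousOn
  have hsq : ‖G x - G y‖ ^ 2 ≤ (b - a) * ∫ t in a..b, ‖deriv G t‖ ^ 2 := by
    rw [← Real.sqrt_le_sqrt_iff (mul_nonneg (sub_nonneg.2 hab)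
      (integral_nonneg hab fun t _ => sq_nonneg _)), Real.sqrt_sq (norm_nonneg _),
      Real.sqrt_mul (sub_nonneg.2 hab)]
    exact hosc.trans hcs
  have htri : ‖G x‖ ≤ ‖G y‖ + ‖G x - G y‖ := norm_le_norm_add_norm_sub' _ _
  nlinarith [pow_le_pow_left₀ (norm_nonneg _) htri 2, sq_nonneg (‖G y‖ - ‖G x - G y‖)]

lemma integral_le_integral_of_tiles {f g : ℝ → ℝ} {a δ : ℝ} {N : ℕ} (hδ : 0 ≤ δ)
    (hf : IntervalIntegrable f volume a (a + N * δ))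
    (hg : IntervalIntegrable g volume a (a + N * δ))
    (h : ∀ t, a ≤ t → t + δ ≤ a + N * δ → ∫ x in t..t + δ, f x ≤ ∫ x in t..t + δ, g x) :
    ∫ x in a..a + N * δ, f x ≤ ∫ x in a..a + N * δ, g x := by
  have hnode : ∀ n < N, a ≤ a + n * δ ∧ a + n * δ + δ ≤ a + N * δ := fun n hn => by
    have : (n : ℝ) + 1 ≤ N := by exact_mod_cast hn
    constructor <;> nlinarith [n.cast_nonneg (α := ℝ)]
  have hsum {u : ℝ → ℝ} (hu : IntervalIntegrable u volume a (a + N * δ)) :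
      ∫ x in a..a + N * δ, u x =
        ∑ n ∈ Finset.range N, ∫ x in a + n * δ..a + n * δ + δ, u x := by
    have key := sum_integral_adjacent_intervals (a := fun n : ℕ => a + n * δ) (n := N) (f := u)
      (μ := volume) fun n hn => hu.mono_set <| by
        obtain ⟨h1, h2⟩ := hnode n hn
        push_cast
        rw [uIcc_of_le (by linarith), uIcc_of_le (by linarith)]
        exact Icc_subset_Icc h1 (by linarith)
    simpa [add_mul, add_assoc] using key.symm
  rw [hsum hf, hsum hg]
  exact Finset.sum_le_sum fun n hn =>
    let ⟨h1, h2⟩ := hnode n (Finset.mem_range.1 hn)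
    h _ h1 h2

/-- The differential expression `-ν G'' + i W G`; here `W` plays the role of `k v - s` for a point
`i s` of the imaginary axis. -/
def modelOp (ν : ℝ) (W : ℝ → ℝ) (G : ℝ → ℂ) (x : ℝ) : ℂ :=
  -(ν : ℂ) * deriv (deriv G) x + Complex.I * W x * G x

/-- The flux `G' conj(G)`, whose derivative is the total derivative produced by integrating
`G'' conj(G)` by parts. -/
def flux (G : ℝ → ℂ) (x : ℝ) : ℂ := deriv G x * conj (G x)

lemma norm_flux (G : ℝ → ℂ) (x : ℝ) : ‖flux G x‖ = ‖deriv G x‖ * ‖G x‖ := by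
  rw [flux, norm_mul, RCLike.norm_conj]

lemma contDiff_deriv_of_contDiff_two {F : Type*} [NormedAddCommGroup F] [NormedSpace ℝ F]
    {G : ℝ → F} (hG : ContDiff ℝ 2 G) : ContDiff ℝ 1 (deriv G) :=
  ((contDiff_succ_iff_deriv (n := 1)).1 hG).2.2

variable {G : ℝ → ℂ} {W : ℝ → ℝ} {ν : ℝ}

lemma contDiff_flux (hG : ContDiff ℝ 2 G) : ContDiff ℝ 1 (flux G) :=
  (contDiff_deriv_of_contDiff_two hG).mul (Complex.conjCLE.contDiff.comp (hG.of_le one_le_two))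

lemma hasDerivAt_flux (hG : ContDiff ℝ 2 G) (x : ℝ) :
    HasDerivAt (flux G) (deriv (flux G) x) x :=
  (contDiff_flux hG).differentiable one_ne_zero x |>.hasDerivAt

lemma deriv_flux (hG : ContDiff ℝ 2 G) (x : ℝ) :
    deriv (flux G) x = deriv (deriv G) x * conj (G x) + deriv G x * conj (deriv G x) :=
  (((contDiff_deriv_of_contDiff_two hG).differentiable one_ne_zero x).hasDerivAt.mul
    ((hG.differentiable two_ne_zero x).hasDerivAt.star)).deriv

lemma modelOp_mul_conj (hG : ContDiff ℝ 2 G) (x : ℝ) :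
    modelOp ν W G x * conj (G x) =
      (ν * ‖deriv G x‖ ^ 2 : ℝ) + Complex.I * (W x * ‖G x‖ ^ 2 : ℝ) - ν * deriv (flux G) x := by
  rw [deriv_flux hG, Complex.mul_conj, modelOp, add_mul, mul_assoc _ (G x), Complex.mul_conj]
  push_cast [Complex.normSq_eq_norm_sq]
  ring

lemma continuousOn_modelOp (hG : ContDiff ℝ 2 G) {s : Set ℝ} (hW : ContinuousOn W s) :
    ContinuousOn (modelOp ν W G) s :=
  (continuous_const.mul (contDiff_deriv_of_contDiff_two hG).continuous_deriv_one).continuousOn.add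
    ((continuousOn_const.mul (Complex.continuous_ofReal.comp_continuousOn hW)).mul
      hG.continuous.continuousOn)

lemma intervalIntegrable_norm_modelOp_mul_norm (hG : ContDiff ℝ 2 G) {a b : ℝ} (hab : a ≤ b)
    (hW : ContinuousOn W (Icc a b)) :
    IntervalIntegrable (fun x => ‖modelOp ν W G x‖ * ‖G x‖) volume a b :=
  ((continuousOn_modelOp hG hW).norm.mul hG.continuous.norm.continuousOn).intervalIntegrable_of_Icc
    hab

lemma integral_norm_deriv_sq_le (hG : ContDiff ℝ 2 G) {a b : ℝ} (hab : a ≤ b)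
    (hW : ContinuousOn W (Icc a b)) (ha : deriv G a = 0) (hb : deriv G b = 0) :
    ν * ∫ x in a..b, ‖deriv G x‖ ^ 2 ≤ ∫ x in a..b, ‖modelOp ν W G x‖ * ‖G x‖ := by
  have cG' : Continuous (deriv G) := hG.continuous_deriv one_le_two
  have cflux : Continuous fun x => (deriv (flux G) x).re :=
    Complex.continuous_re.comp (contDiff_flux hG).continuous_deriv_one
  have hflux : ∫ x in a..b, (deriv (flux G) x).re = 0 := by
    have hderiv : ∀ x, HasDerivAt (fun x => (flux G x).re) (deriv (flux G) x).re x := fun x =>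
      Complex.reCLM.hasFDerivAt.comp_hasDerivAt x (hasDerivAt_flux hG x)
    rw [integral_eq_sub_of_hasDerivAt (fun x _ => hderiv x) (cflux.intervalIntegrable _ _)]
    simp [flux, ha, hb]
  have hpointwise : ∀ x ∈ Icc a b, ν * ‖deriv G x‖ ^ 2 ≤
      ‖modelOp ν W G x‖ * ‖G x‖ + ν * (deriv (flux G) x).re := fun x _ => by
    have hre : (modelOp ν W G x * conj (G x)).re =
        ν * ‖deriv G x‖ ^ 2 - ν * (deriv (flux G) x).re := by
      rw [modelOp_mul_conj hG]
      simp [-Complex.ofReal_mul, -Complex.ofReal_pow]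
    have hle := Complex.re_le_norm (modelOp ν W G x * conj (G x))
    rw [norm_mul, RCLike.norm_conj] at hle
    linarith
  have iop := intervalIntegrable_norm_modelOp_mul_norm (ν := ν) hG hab hW
  have iflux := (cflux.const_mul ν).intervalIntegrable (μ := volume) a b
  calc ν * ∫ x in a..b, ‖deriv G x‖ ^ 2 = ∫ x in a..b, ν * ‖deriv G x‖ ^ 2 :=
        (intervalIntegral.integral_const_mul _ _).symm
    _ ≤ ∫ x in a..b, (‖modelOp ν W G x‖ * ‖G x‖ + ν * (deriv (flux G) x).re) :=
        integral_mono_on hab ((cG'.norm.pow 2).const_mul ν |>.intervalIntegrable _ _)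
          (iop.add iflux) hpointwise
    _ = ∫ x in a..b, ‖modelOp ν W G x‖ * ‖G x‖ := by
        rw [integral_add iop iflux, intervalIntegral.integral_const_mul, hflux, mul_zero, add_zero]

/-- The parabola on `[p, q]` vanishing at the endpoints with maximal value one; it localizes the
imaginary part of the energy identity to an interval where `W` has a constant sign. -/
def parabolaBump (p q x : ℝ) : ℝ := 4 * (x - p) * (q - x) / (q - p) ^ 2

lemma hasDerivAt_parabolaBump (p q x : ℝ) :
    HasDerivAt (parabolaBump p q) (4 * (p + q - 2 * x) / (q - p) ^ 2) x := by
  refine (((((hasDerivAt_id x).sub_const p).const_mul 4).mul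
    ((hasDerivAt_id x).const_sub q)).div_const ((q - p) ^ 2)).congr_deriv ?_
  simp only [id]
  ring

lemma contDiff_parabolaBump (p q : ℝ) : ContDiff ℝ 1 (parabolaBump p q) := by
  unfold parabolaBump
  fun_prop

lemma parabolaBump_nonneg {p q x : ℝ} (hx : x ∈ Icc p q) : 0 ≤ parabolaBump p q x := by
  have hpx : 0 ≤ x - p := sub_nonneg.2 hx.1
  have hxq : 0 ≤ q - x := sub_nonneg.2 hx.2
  unfold parabolaBump
  positivity

lemma parabolaBump_le_one (p q x : ℝ) : parabolaBump p q x ≤ 1 :=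
  div_le_one_of_le₀ (by nlinarith [sq_nonneg (2 * x - p - q)]) (sq_nonneg _)

lemma abs_deriv_parabolaBump_le {p q x : ℝ} (hx : x ∈ Icc p q) :
    |deriv (parabolaBump p q) x| ≤ 4 / (q - p) := by
  have hpq : 0 ≤ q - p := by linarith [hx.1, hx.2]
  have hx' : |p + q - 2 * x| ≤ q - p := abs_le.2 ⟨by linarith [hx.2], by linarith [hx.1]⟩
  rw [(hasDerivAt_parabolaBump p q x).deriv, abs_div, abs_mul, abs_of_nonneg (sq_nonneg (q - p)),
    abs_of_pos (four_pos : (0 : ℝ) < 4)]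
  calc 4 * |p + q - 2 * x| / (q - p) ^ 2 ≤ 4 * (q - p) / (q - p) ^ 2 := by gcongr
    _ = 4 / (q - p) := by
      rcases hpq.eq_or_lt with h | h
      · simp [← h]
      · field_simp

lemma integral_parabolaBump {p q : ℝ} (hpq : p < q) :
    ∫ x in p..q, parabolaBump p q x = 2 * (q - p) / 3 := by
  have hprim : ∀ x, HasDerivAt (fun x : ℝ => 4 / (q - p) ^ 2 *
      (-(x ^ 3) / 3 + (p + q) * x ^ 2 / 2 - p * q * x)) (parabolaBump p q x) x := fun x => by
    refine ((((((hasDerivAt_id x).pow 3).neg.div_const 3).add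
      ((((hasDerivAt_id x).pow 2).const_mul (p + q)).div_const 2)).sub
      ((hasDerivAt_id x).const_mul (p * q))).const_mul (4 / (q - p) ^ 2)).congr_deriv ?_
    simp only [parabolaBump, id]
    push_cast
    ring
  rw [integral_eq_sub_of_hasDerivAt (fun x _ => hprim x)
    ((contDiff_parabolaBump p q).continuous.intervalIntegrable _ _)]
  have : q - p ≠ 0 := (sub_pos.2 hpq).ne'
  field_simp
  ring

lemma integral_deriv_mul_add_mul_deriv_parabolaBump {p q : ℝ} {f f' : ℝ → ℝ}
    (hf : ∀ x, HasDerivAt f (f' x) x) (hf' : Continuous f') :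
    ∫ x in p..q, (deriv (parabolaBump p q) x * f x + parabolaBump p q x * f' x) = 0 := by
  have hφ := contDiff_parabolaBump p q
  rw [integral_deriv_mul_eq_sub
    (fun x _ => (hφ.differentiable one_ne_zero x).hasDerivAt) (fun x _ => hf x)
    (hφ.continuous_deriv_one.intervalIntegrable _ _) (hf'.intervalIntegrable _ _)]
  simp [parabolaBump]

lemma mul_parabolaBump_le (hG : ContDiff ℝ 2 G) {p q η M ε x : ℝ} (hν : 0 ≤ ν) (hη : 0 ≤ η)
    (hε : |ε| = 1) (hx : x ∈ Icc p q) (hW : η ≤ ε * W x) (hM : M ≤ ‖G x‖ ^ 2) :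
    η * M * parabolaBump p q x ≤
      ‖modelOp ν W G x‖ * ‖G x‖ + 4 * ν / (q - p) * (‖deriv G x‖ * ‖G x‖) +
        ε * ν * (deriv (parabolaBump p q) x * (flux G x).im +
          parabolaBump p q x * (deriv (flux G) x).im) := by
  set φ := parabolaBump p q x
  set φ' := deriv (parabolaBump p q) x
  have hφ0 : 0 ≤ φ := parabolaBump_nonneg hx
  have him : (modelOp ν W G x * conj (G x)).im =
      W x * ‖G x‖ ^ 2 - ν * (deriv (flux G) x).im := by
    rw [modelOp_mul_conj hG]
    simp [-Complex.ofReal_mul, -Complex.ofReal_pow]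
  have hsign : η * M * φ ≤ ε * W x * ‖G x‖ ^ 2 * φ := by
    gcongr ?_ * φ
    exact (mul_le_mul_of_nonneg_left hM hη).trans (by gcongr)
  have hop : ε * φ * (modelOp ν W G x * conj (G x)).im ≤ ‖modelOp ν W G x‖ * ‖G x‖ := by
    refine (le_abs_self _).trans ?_
    rw [abs_mul, abs_mul, hε, one_mul, abs_of_nonneg hφ0]
    refine (mul_le_of_le_one_left (abs_nonneg _) (parabolaBump_le_one p q x)).trans ?_
    exact (Complex.abs_im_le_norm _).trans_eq (by rw [norm_mul, RCLike.norm_conj])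
  have hflux : -(ε * ν * φ' * (flux G x).im) ≤ 4 * ν / (q - p) * (‖deriv G x‖ * ‖G x‖) := by
    refine (neg_le_abs _).trans ?_
    rw [abs_mul, abs_mul, abs_mul, hε, one_mul, abs_of_nonneg hν, ← norm_flux,
      show 4 * ν / (q - p) = ν * (4 / (q - p)) by ring]
    gcongr
    · exact mul_nonneg hν ((abs_nonneg _).trans (abs_deriv_parabolaBump_le hx))
    · exact abs_deriv_parabolaBump_le hx
    · exact Complex.abs_im_le_norm _
  rw [him] at hop
  linarith

lemma multiplier_estimate (hG : ContDiff ℝ 2 G) {p q η M : ℝ} (hpq : p < q) (hν : 0 ≤ ν)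
    (hη : 0 ≤ η) (hW : ContinuousOn W (Icc p q)) (hsign : HasSignedLowerBound W η (Icc p q))
    (hM : ∀ x ∈ Icc p q, M ≤ ‖G x‖ ^ 2) :
    η * M * (2 * (q - p) / 3) ≤ (∫ x in p..q, ‖modelOp ν W G x‖ * ‖G x‖) +
      4 * ν / (q - p) * ∫ x in p..q, ‖deriv G x‖ * ‖G x‖ := by
  obtain ⟨ε, hε, hεW⟩ := hsign
  have hφ := contDiff_parabolaBump p q
  have hJ := contDiff_flux hG
  have cflux' : Continuous fun x => (deriv (flux G) x).im :=
    Complex.continuous_im.comp hJ.continuous_deriv_one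
  have hflux' : ∀ x, HasDerivAt (fun x => (flux G x).im) (deriv (flux G) x).im x := fun x =>
    Complex.imCLM.hasFDerivAt.comp_hasDerivAt x (hasDerivAt_flux hG x)
  have hflux : ∫ x in p..q, (deriv (parabolaBump p q) x * (flux G x).im +
      parabolaBump p q x * (deriv (flux G) x).im) = 0 :=
    integral_deriv_mul_add_mul_deriv_parabolaBump hflux' cflux'
  have iop := intervalIntegrable_norm_modelOp_mul_norm (ν := ν) hG hpq.le hW
  have ider : IntervalIntegrable (fun x => ‖deriv G x‖ * ‖G x‖) volume p q :=
    ((hG.continuous_deriv one_le_two).norm.mul hG.continuous.norm).intervalIntegrable _ _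
  have iflux : IntervalIntegrable (fun x => deriv (parabolaBump p q) x * (flux G x).im +
      parabolaBump p q x * (deriv (flux G) x).im) volume p q :=
    ((hφ.continuous_deriv_one.mul (Complex.continuous_im.comp hJ.continuous)).add
      (hφ.continuous.mul cflux')).intervalIntegrable _ _
  calc η * M * (2 * (q - p) / 3) = ∫ x in p..q, η * M * parabolaBump p q x := by
        rw [intervalIntegral.integral_const_mul, integral_parabolaBump hpq]
    _ ≤ ∫ x in p..q, (‖modelOp ν W G x‖ * ‖G x‖ + 4 * ν / (q - p) * (‖deriv G x‖ * ‖G x‖) +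
          ε * ν * (deriv (parabolaBump p q) x * (flux G x).im +
            parabolaBump p q x * (deriv (flux G) x).im)) :=
        integral_mono_on hpq.le
          ((hφ.continuous.const_mul _).intervalIntegrable _ _)
          ((iop.add (ider.const_mul _)).add (iflux.const_mul _))
          fun x hx => mul_parabolaBump_le hG hν hη hε hx (hεW x hx) (hM x hx)
    _ = _ := by
        rw [integral_add (iop.add (ider.const_mul _)) (iflux.const_mul _),
          integral_add iop (ider.const_mul _), intervalIntegral.integral_const_mul,
          intervalIntegral.integral_const_mul, hflux, mul_zero, add_zero]

end LocalEstimate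

section IntervalEstimate

open intervalIntegral

variable {G : ℝ → ℂ} {W : ℝ → ℝ} {ν : ℝ}

lemma exists_norm_sq_le_of_hasSignedSubinterval (hG : ContDiff ℝ 2 G) {a b L η : ℝ} (hL : 0 < L)
    (hν : 0 ≤ ν) (hη : 0 < η) (hW : ContinuousOn W (Icc a b))
    (hsign : HasSignedSubinterval W η L (Icc a b)) :
    ∃ y ∈ Icc a b, 2 * ‖G y‖ ^ 2 ≤ 3 / (η * L) * ((∫ x in a..b, ‖modelOp ν W G x‖ * ‖G x‖) +
      4 * ν / L * ∫ x in a..b, ‖deriv G x‖ * ‖G x‖) := by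
  obtain ⟨p, hp, hsign⟩ := hsign
  have hpL : p < p + L := by linarith
  obtain ⟨hap, hpb⟩ := (Icc_subset_Icc_iff hpL.le).1 hp
  obtain ⟨y, hy, hmin⟩ := (isCompact_Icc (a := p) (b := p + L)).exists_isMinOn
    (nonempty_Icc.2 hpL.le) (hG.continuous.norm.pow 2).continuousOn
  have hmult := multiplier_estimate hG (M := ‖G y‖ ^ 2) hpL hν hη.le (hW.mono hp) hsign
    fun x hx => hmin hx
  rw [add_sub_cancel_left] at hmult
  have enlarge : ∀ {f : ℝ → ℝ}, (∀ x, 0 ≤ f x) → IntervalIntegrable f volume a b →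
      ∫ x in p..p + L, f x ≤ ∫ x in a..b, f x := fun hf0 hf =>
    integral_mono_interval hap hpL.le hpb (ae_of_all _ hf0) hf
  refine ⟨y, hp hy, ?_⟩
  calc 2 * ‖G y‖ ^ 2 = 3 / (η * L) * (η * ‖G y‖ ^ 2 * (2 * L / 3)) := by field_simp
    _ ≤ _ := by
      refine mul_le_mul_of_nonneg_left (hmult.trans (add_le_add ?_ ?_)) (by positivity)
      · exact enlarge (fun x => by positivity)
          (intervalIntegrable_norm_modelOp_mul_norm hG (hap.trans (hpL.le.trans hpb)) hW)
      · refine mul_le_mul_of_nonneg_left (enlarge (fun x => by positivity) ?_) (by positivity)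
        exact ((hG.continuous_deriv one_le_two).norm.mul
          hG.continuous.norm).intervalIntegrable _ _

lemma integral_norm_sq_le_of_hasSignedSubinterval (hG : ContDiff ℝ 2 G) {a δ L η : ℝ} (hL : 0 < L)
    (hδ : 0 ≤ δ) (hν : 0 ≤ ν) (hη : 0 < η) (hW : ContinuousOn W (Icc a (a + δ)))
    (hsign : HasSignedSubinterval W η L (Icc a (a + δ))) :
    ∫ x in a..a + δ, ‖G x‖ ^ 2 ≤ 3 * δ / (η * L) *
      ((∫ x in a..a + δ, ‖modelOp ν W G x‖ * ‖G x‖) +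
        4 * ν / L * ∫ x in a..a + δ, ‖deriv G x‖ * ‖G x‖) +
      2 * δ ^ 2 * ∫ x in a..a + δ, ‖deriv G x‖ ^ 2 := by
  obtain ⟨y, hy, hGy⟩ := exists_norm_sq_le_of_hasSignedSubinterval hG hL hν hη hW hsign
  have hosc : ∀ x ∈ Icc a (a + δ), ‖G x‖ ^ 2 ≤
      2 * ‖G y‖ ^ 2 + 2 * δ * ∫ t in a..a + δ, ‖deriv G t‖ ^ 2 := fun x hx => by
    simpa using norm_sq_le_two_mul_add_integral_deriv (hG.of_le one_le_two) hx hy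
  have hint := integral_mono_on (f := fun x => ‖G x‖ ^ 2) (by linarith)
    ((hG.continuous.norm.pow 2).intervalIntegrable _ _)
    (continuous_const.intervalIntegrable (μ := volume) _ _) hosc
  rw [intervalIntegral.integral_const, smul_eq_mul, add_sub_cancel_left] at hint
  have hmean := mul_le_mul_of_nonneg_left hGy hδ
  rw [← mul_assoc δ (3 / (η * L)), mul_div_left_comm, mul_div_assoc'] at hmean
  linarith

lemma integral_norm_sq_le_of_tiles (hG : ContDiff ℝ 2 G) {a δ L η : ℝ} {N : ℕ} (hL : 0 < L)
    (hδ : 0 ≤ δ) (hν : 0 ≤ ν) (hη : 0 < η) (hW : ContinuousOn W (Icc a (a + N * δ)))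
    (hsign : ∀ t, a ≤ t → t + δ ≤ a + N * δ → HasSignedSubinterval W η L (Icc t (t + δ))) :
    ∫ x in a..a + N * δ, ‖G x‖ ^ 2 ≤ 3 * δ / (η * L) *
      ((∫ x in a..a + N * δ, ‖modelOp ν W G x‖ * ‖G x‖) +
        4 * ν / L * ∫ x in a..a + N * δ, ‖deriv G x‖ * ‖G x‖) +
      2 * δ ^ 2 * ∫ x in a..a + N * δ, ‖deriv G x‖ ^ 2 := by
  have cG := hG.continuous
  have cG' : Continuous (deriv G) := hG.continuous_deriv one_le_two
  have hab : a ≤ a + N * δ := le_add_of_nonneg_right (by positivity)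
  have linear : ∀ {s t : ℝ}, s ≤ t → Icc s t ⊆ Icc a (a + N * δ) →
      IntervalIntegrable (fun x => 3 * δ / (η * L) * (‖modelOp ν W G x‖ * ‖G x‖ +
        4 * ν / L * (‖deriv G x‖ * ‖G x‖)) + 2 * δ ^ 2 * ‖deriv G x‖ ^ 2) volume s t ∧
      ∫ x in s..t, (3 * δ / (η * L) * (‖modelOp ν W G x‖ * ‖G x‖ +
        4 * ν / L * (‖deriv G x‖ * ‖G x‖)) + 2 * δ ^ 2 * ‖deriv G x‖ ^ 2) =
      3 * δ / (η * L) * ((∫ x in s..t, ‖modelOp ν W G x‖ * ‖G x‖) +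
        4 * ν / L * ∫ x in s..t, ‖deriv G x‖ * ‖G x‖) +
      2 * δ ^ 2 * ∫ x in s..t, ‖deriv G x‖ ^ 2 := fun {s t} hst hsub => by
    have iop := intervalIntegrable_norm_modelOp_mul_norm (ν := ν) hG hst (hW.mono hsub)
    have ider : IntervalIntegrable (fun x => ‖deriv G x‖ * ‖G x‖) volume s t :=
      (cG'.norm.mul cG.norm).intervalIntegrable _ _
    have isq : IntervalIntegrable (fun x => ‖deriv G x‖ ^ 2) volume s t :=
      (cG'.norm.pow 2).intervalIntegrable _ _
    refine ⟨((iop.add (ider.const_mul _)).const_mul _).add (isq.const_mul _), ?_⟩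
    rw [integral_add ((iop.add (ider.const_mul _)).const_mul _) (isq.const_mul _),
      intervalIntegral.integral_const_mul, integral_add iop (ider.const_mul _),
      intervalIntegral.integral_const_mul, intervalIntegral.integral_const_mul]
  obtain ⟨hint, hsum⟩ := linear hab Subset.rfl
  rw [← hsum]
  refine integral_le_integral_of_tiles hδ ((cG.norm.pow 2).intervalIntegrable _ _) hint
    fun t hat htb => ?_
  have hsub : Icc t (t + δ) ⊆ Icc a (a + N * δ) := Icc_subset_Icc hat htb
  rw [(linear (by linarith) hsub).2]
  exact integral_norm_sq_le_of_hasSignedSubinterval hG hL hδ hν hη (hW.mono hsub)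
    (hsign t hat htb)

lemma le_of_quadratic_bounds {A B F K α β δ ν r : ℝ} (hA : 0 ≤ A) (hF : 0 ≤ F) (hr : 0 < r)
    (hmain : A ^ 2 ≤ α * (F * A + β * (B * A)) + 2 * δ ^ 2 * B ^ 2)
    (hen : ν * B ^ 2 ≤ F * A) (h₁ : α * r ≤ K) (h₂ : (α * β) ^ 2 * r ≤ K ^ 2 * ν)
    (h₃ : δ ^ 2 * r ≤ ν) : r * A ≤ (2 * K + K ^ 2 + 4) * F := by
  rcases hA.eq_or_lt with rfl | hA
  · have : 0 ≤ 2 * K + K ^ 2 + 4 := by nlinarith [sq_nonneg (K + 1)]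
    rw [mul_zero]
    positivity
  have hforce : α * r * (F * A) ≤ K * (F * A) := by gcongr
  have hosc : δ ^ 2 * r * B ^ 2 ≤ F * A :=
    (mul_le_mul_of_nonneg_right h₃ (sq_nonneg B)).trans hen
  have hcross : r * (α * β * B * A) ≤ r * A ^ 2 / 2 + K ^ 2 * (F * A) / 2 := by
    have : (α * β) ^ 2 * r * B ^ 2 ≤ K ^ 2 * (F * A) := by
      refine (mul_le_mul_of_nonneg_right h₂ (sq_nonneg B)).trans ?_
      rw [mul_assoc]
      exact mul_le_mul_of_nonneg_left hen (sq_nonneg K)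
    nlinarith [mul_nonneg hr.le (sq_nonneg (α * β * B - A))]
  have hmain' := mul_le_mul_of_nonneg_left hmain hr.le
  exact le_of_mul_le_mul_right (a := A) (by nlinarith) hA

theorem interval_estimate (hG : ContDiff ℝ 2 G) {a δ L η K r : ℝ} {N : ℕ} (hL : 0 < L)
    (hδ : 0 ≤ δ) (hν : 0 ≤ ν) (hη : 0 < η) (hr : 0 < r) (hW : ContinuousOn W (Icc a (a + N * δ)))
    (hsign : ∀ t, a ≤ t → t + δ ≤ a + N * δ → HasSignedSubinterval W η L (Icc t (t + δ)))
    (ha : deriv G a = 0) (hb : deriv G (a + N * δ) = 0) (h₁ : 3 * δ / (η * L) * r ≤ K)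
    (h₂ : (3 * δ / (η * L) * (4 * ν / L)) ^ 2 * r ≤ K ^ 2 * ν) (h₃ : δ ^ 2 * r ≤ ν) :
    r * √(∫ x in a..a + N * δ, ‖G x‖ ^ 2) ≤
      (2 * K + K ^ 2 + 4) * √(∫ x in a..a + N * δ, ‖modelOp ν W G x‖ ^ 2) := by
  have hab : a ≤ a + N * δ := le_add_of_nonneg_right (by positivity)
  have cG : ContinuousOn G (Icc a (a + N * δ)) := hG.continuous.continuousOn
  have cG' : ContinuousOn (deriv G) (Icc a (a + N * δ)) :=
    (hG.continuous_deriv one_le_two).continuousOn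
  have cop := continuousOn_modelOp (ν := ν) hG hW
  have sq_norm (u : ℝ → ℂ) :
      √(∫ x in a..a + N * δ, ‖u x‖ ^ 2) ^ 2 = ∫ x in a..a + N * δ, ‖u x‖ ^ 2 :=
    Real.sq_sqrt (integral_nonneg hab fun x _ => sq_nonneg _)
  refine le_of_quadratic_bounds (B := √(∫ x in a..a + N * δ, ‖deriv G x‖ ^ 2))
    (Real.sqrt_nonneg _) (Real.sqrt_nonneg _) hr ?_ ?_ h₁ h₂ h₃
  · rw [sq_norm G, sq_norm (deriv G)]
    refine (integral_norm_sq_le_of_tiles hG hL hδ hν hη hW hsign).trans ?_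
    gcongr
    · exact intervalIntegral_norm_mul_norm_le_sqrt_mul_sqrt hab cop cG
    · exact intervalIntegral_norm_mul_norm_le_sqrt_mul_sqrt hab cG' cG
  · rw [sq_norm (deriv G)]
    exact (integral_norm_deriv_sq_le hG hab hW ha hb).trans
      (intervalIntegral_norm_mul_norm_le_sqrt_mul_sqrt hab cop cG)

end IntervalEstimate

section WeakDerivative

variable {E : Type*} [NormedAddCommGroup E] [NormedSpace ℝ E]

/-- Smooth compactly supported functions on the line. -/
structure IsTestFunction (φ : ℝ → E) : Prop where
  contDiff : ContDiff ℝ ∞ φ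
  hasCompactSupport : HasCompactSupport φ

namespace IsTestFunction

variable {φ ψ : ℝ → E}

lemma continuous (hφ : IsTestFunction φ) : Continuous φ := hφ.contDiff.continuous

lemma differentiable (hφ : IsTestFunction φ) : Differentiable ℝ φ :=
  hφ.contDiff.differentiable (by simp)

lemma deriv (hφ : IsTestFunction φ) : IsTestFunction (deriv φ) :=
  ⟨(contDiff_infty_iff_deriv.1 hφ.contDiff).2, hφ.hasCompactSupport.deriv⟩

lemma integrable (hφ : IsTestFunction φ) : Integrable φ :=
  hφ.continuous.integrable_of_hasCompactSupport hφ.hasCompactSupport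

lemma sub (hφ : IsTestFunction φ) (hψ : IsTestFunction ψ) :
    IsTestFunction fun x => φ x - ψ x :=
  ⟨hφ.contDiff.sub hψ.contDiff, hφ.hasCompactSupport.sub hψ.hasCompactSupport⟩

lemma const_smul (hφ : IsTestFunction φ) (c : ℝ) : IsTestFunction fun x => c • φ x :=
  ⟨contDiff_const.smul hφ.contDiff, hφ.hasCompactSupport.smul_left (f := fun _ => c)⟩

lemma integrable_smul {φ : ℝ → ℝ} (hφ : IsTestFunction φ) {f : ℝ → E}
    (hf : LocallyIntegrable f) : Integrable fun x => φ x • f x :=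
  hf.integrable_smul_left_of_hasCompactSupport hφ.continuous hφ.hasCompactSupport

end IsTestFunction

lemma exists_isTestFunction_integral_eq_one : ∃ θ : ℝ → ℝ, IsTestFunction θ ∧ ∫ x, θ x = 1 :=
  let b : ContDiffBump (0 : ℝ) := ⟨1, 2, one_pos, one_lt_two⟩
  ⟨b.normed volume, ⟨b.contDiff_normed, b.hasCompactSupport_normed⟩, b.integral_normed⟩

lemma exists_tsupport_subset_Ioo {α : Type*} [Zero α] {φ : ℝ → α} (hφ : HasCompactSupport φ) :
    ∃ R : ℝ, 0 < R ∧ tsupport φ ⊆ Ioo (-R) R := by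
  obtain ⟨R, hR, hφR⟩ := hφ.isCompact.isBounded.subset_ball_lt 0 0
  exact ⟨R, hR, by simpa [Real.ball_eq_Ioo] using hφR⟩

omit [NormedSpace ℝ E] in
lemma intervalIntegrable_of_locallyIntegrable {f : ℝ → E} (hf : LocallyIntegrable f) (a b : ℝ) :
    IntervalIntegrable f volume a b :=
  (hf.integrableOn_isCompact isCompact_uIcc).intervalIntegrable

lemma hasDerivAt_intervalIntegral [CompleteSpace E] {f : ℝ → E} (hf : Continuous f) (a x : ℝ) :
    HasDerivAt (fun x => ∫ t in a..x, f t) (f x) x :=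
  intervalIntegral.integral_hasDerivAt_right (hf.intervalIntegrable _ _)
    hf.stronglyMeasurable.stronglyMeasurableAtFilter hf.continuousAt

lemma continuous_intervalIntegral {f : ℝ → E} (hf : LocallyIntegrable f) (a : ℝ) :
    Continuous fun x => ∫ t in a..x, f t :=
  intervalIntegral.continuous_primitive (intervalIntegrable_of_locallyIntegrable hf) a

lemma IsTestFunction.exists_deriv_eq [CompleteSpace E] {χ : ℝ → E} (hχ : IsTestFunction χ)
    (h0 : ∫ x, χ x = 0) : ∃ ψ : ℝ → E, IsTestFunction ψ ∧ _root_.deriv ψ = χ := by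
  obtain ⟨R, -, hχR⟩ := exists_tsupport_subset_Ioo hχ.hasCompactSupport
  have hzero : ∀ x, x ∉ Ioo (-R) R → χ x = 0 := fun x hx =>
    image_eq_zero_of_notMem_tsupport fun h => hx (hχR h)
  have hderiv : _root_.deriv (fun x => ∫ t in -R..x, χ t) = χ := funext fun x =>
    (hasDerivAt_intervalIntegral hχ.continuous _ x).deriv
  refine ⟨_, ⟨?_, HasCompactSupport.intro (isCompact_Icc (a := -R) (b := R)) fun x hx => ?_⟩,
    hderiv⟩
  · rw [contDiff_infty_iff_deriv, hderiv]
    exact ⟨fun x => (hasDerivAt_intervalIntegral hχ.continuous _ x).differentiableAt, hχ.contDiff⟩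
  · rcases le_or_gt x (-R) with hxR | hxR
    · refine (intervalIntegral.integral_congr (g := fun _ => (0 : E)) fun t ht => ?_).trans
        (by simp)
      rw [uIcc_of_ge hxR] at ht
      exact hzero t fun h => h.1.not_ge ht.2
    · rw [← h0, intervalIntegral.integral_eq_integral_of_support_subset]
      intro t ht
      have htR := hχR (subset_tsupport χ ht)
      exact ⟨htR.1, (htR.2.trans (lt_of_not_ge fun h => hx ⟨hxR.le, h⟩)).le⟩

lemma IsTestFunction.exists_deriv_eq_sub_integral_mul {χ θ : ℝ → ℝ} (hχ : IsTestFunction χ)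
    (hθ : IsTestFunction θ) (hθ1 : ∫ x, θ x = 1) :
    ∃ ψ : ℝ → ℝ, IsTestFunction ψ ∧ _root_.deriv ψ = fun x => χ x - (∫ t, χ t) * θ x :=
  (hχ.sub (hθ.const_smul (∫ t, χ t))).exists_deriv_eq <| by
    rw [integral_sub hχ.integrable (hθ.const_smul _).integrable, integral_smul, hθ1, smul_eq_mul,
      mul_one, sub_self]

/-- `h` is the weak derivative of `f` on the whole line, for functions with values in a normed
space. -/
def HasWeakDeriv (f h : ℝ → E) : Prop :=
  ∀ φ : ℝ → ℝ, IsTestFunction φ → ∫ x, deriv φ x • f x = -∫ x, φ x • h x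

lemma HasWeakDeriv.sub {f₁ f₂ h₁ h₂ : ℝ → E} (w₁ : HasWeakDeriv f₁ h₁) (w₂ : HasWeakDeriv f₂ h₂)
    (hf₁ : LocallyIntegrable f₁) (hf₂ : LocallyIntegrable f₂) (hh₁ : LocallyIntegrable h₁)
    (hh₂ : LocallyIntegrable h₂) :
    HasWeakDeriv (fun x => f₁ x - f₂ x) fun x => h₁ x - h₂ x := fun φ hφ => by
  simp only [smul_sub]
  rw [integral_sub (hφ.deriv.integrable_smul hf₁) (hφ.deriv.integrable_smul hf₂),
    integral_sub (hφ.integrable_smul hh₁) (hφ.integrable_smul hh₂), w₁ φ hφ, w₂ φ hφ]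
  abel

lemma integral_deriv_mul_intervalIntegral {φ h : ℝ → ℝ} (hφ : IsTestFunction φ)
    (hh : LocallyIntegrable h) :
    ∫ x, deriv φ x * ∫ t in (0 : ℝ)..x, h t = -∫ x, φ x * h x := by
  obtain ⟨R, hR, hφR⟩ := exists_tsupport_subset_Ioo hφ.hasCompactSupport
  have hzero : ∀ x, x ∉ Ioo (-R) R → φ x = 0 := fun x hx =>
    image_eq_zero_of_notMem_tsupport fun h => hx (hφR h)
  have hint := intervalIntegrable_of_locallyIntegrable hh (-R) R
  have hparts := (hφ.contDiff.of_le (by simp)).contDiffOn.absolutelyContinuousOnInterval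
    |>.integral_mul_deriv_eq_deriv_mul <|
      hint.absolutelyContinuousOnInterval_intervalIntegral (c := 0)
        (by rw [uIcc_of_le (by linarith)]; constructor <;> linarith)
  rw [hzero R (by simp), hzero (-R) (by simp)] at hparts
  have hderiv : ∫ x in -R..R, φ x * deriv (fun x => ∫ t in (0 : ℝ)..x, h t) x =
      ∫ x in -R..R, φ x * h x := by
    refine intervalIntegral.integral_congr_ae ?_
    filter_upwards [hint.ae_hasDerivAt_integral] with x hx hxR
    rw [(hx (uIoc_subset_uIcc hxR) 0 (by
      rw [uIcc_of_le (by linarith)]; constructor <;> linarith)).deriv]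
  have extend {u w : ℝ → ℝ} (hu : tsupport u ⊆ tsupport φ) :
      ∫ x in -R..R, u x * w x = ∫ x, u x * w x :=
    intervalIntegral.integral_eq_integral_of_support_subset <|
      (Function.support_mul_subset_left u w).trans <| (subset_tsupport u).trans <|
        (hu.trans hφR).trans Ioo_subset_Ioc_self
  rw [hderiv, extend Subset.rfl, extend tsupport_deriv_subset] at hparts
  linarith

variable [CompleteSpace E]

lemma hasWeakDeriv_intervalIntegral {h : ℝ → E} (hh : LocallyIntegrable h) :
    HasWeakDeriv (fun x => ∫ t in (0 : ℝ)..x, h t) h := fun φ hφ => by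
  refine (SeparatingDual.eq_iff_forall_dual_eq (R := ℝ)).2 fun ℓ => ?_
  have hcont := (continuous_intervalIntegral hh 0).locallyIntegrable (μ := volume)
  have hℓ : LocallyIntegrable fun x => ℓ (h x) := fun x => (hh x).imp fun s hs =>
    ⟨hs.1, ℓ.integrable_comp hs.2⟩
  rw [← ℓ.integral_comp_comm (hφ.deriv.integrable_smul hcont), map_neg,
    ← ℓ.integral_comp_comm (hφ.integrable_smul hh)]
  simp only [map_smul, smul_eq_mul, ← ℓ.intervalIntegral_comp_comm
    (intervalIntegrable_of_locallyIntegrable hh _ _)]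
  exact integral_deriv_mul_intervalIntegral hφ hℓ

lemma HasWeakDeriv.exists_ae_eq_const {f : ℝ → E} (hf : LocallyIntegrable f)
    (w : HasWeakDeriv f 0) : ∃ A : E, ∀ᵐ x, f x = A := by
  obtain ⟨θ, hθ, hθ1⟩ := exists_isTestFunction_integral_eq_one
  refine ⟨∫ x, θ x • f x, ae_eq_of_integral_contDiff_smul_eq hf (locallyIntegrable_const _)
    fun χ hχ hχc => ?_⟩
  have hχ' : IsTestFunction χ := ⟨hχ, hχc⟩
  obtain ⟨ψ, hψ, hψχ⟩ := hχ'.exists_deriv_eq_sub_integral_mul hθ hθ1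
  have h0 : ∫ x, deriv ψ x • f x = 0 := by simpa using w ψ hψ
  simp only [hψχ, sub_smul, mul_smul] at h0
  rw [integral_sub (hχ'.integrable_smul hf) ((hθ.integrable_smul hf).fun_smul _), integral_smul,
    sub_eq_zero] at h0
  rw [h0, integral_smul_const]

lemma HasWeakDeriv.exists_ae_eq_add_intervalIntegral {f h : ℝ → E} (w : HasWeakDeriv f h)
    (hf : LocallyIntegrable f) (hh : LocallyIntegrable h) :
    ∃ A : E, ∀ᵐ x, f x = A + ∫ t in (0 : ℝ)..x, h t := by
  have hP := (continuous_intervalIntegral hh 0).locallyIntegrable (μ := volume)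
  have w0 := w.sub (hasWeakDeriv_intervalIntegral hh) hf hP hh hh
  simp only [sub_self] at w0
  obtain ⟨A, hA⟩ := HasWeakDeriv.exists_ae_eq_const (hf.sub hP) w0
  exact ⟨A, hA.mono fun x hx => sub_eq_iff_eq_add.1 hx⟩

lemma exists_hasWeakDeriv_add_intervalIntegral {f h : ℝ → E} (hf : LocallyIntegrable f)
    (hh : LocallyIntegrable h)
    (w : ∀ φ : ℝ → ℝ, IsTestFunction φ → ∫ x, deriv (deriv φ) x • f x = ∫ x, φ x • h x) :
    ∃ B : E, HasWeakDeriv f fun x => B + ∫ t in (0 : ℝ)..x, h t := by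
  obtain ⟨θ, hθ, hθ1⟩ := exists_isTestFunction_integral_eq_one
  have hP : LocallyIntegrable fun x => ∫ t in (0 : ℝ)..x, h t :=
    (continuous_intervalIntegral hh 0).locallyIntegrable
  refine ⟨-((∫ x, θ x • ∫ t in (0 : ℝ)..x, h t) + ∫ x, deriv θ x • f x), fun χ hχ => ?_⟩
  obtain ⟨ψ, hψ, hψχ⟩ := hχ.exists_deriv_eq_sub_integral_mul hθ hθ1
  have hψχ' : deriv (deriv ψ) = fun x => deriv χ x - (∫ t, χ t) * deriv θ x := hψχ ▸ funext fun x =>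
    ((hχ.differentiable x).hasDerivAt.sub ((hθ.differentiable x).hasDerivAt.const_mul _)).deriv
  have key := (w ψ hψ).trans (neg_eq_iff_eq_neg.2 (hasWeakDeriv_intervalIntegral hh ψ hψ)).symm
  rw [hψχ', hψχ] at key
  simp only [sub_smul, mul_smul] at key
  rw [integral_sub (hχ.deriv.integrable_smul hf) ((hθ.deriv.integrable_smul hf).fun_smul _),
    integral_sub (hχ.integrable_smul hP) ((hθ.integrable_smul hP).fun_smul _), integral_smul,
    integral_smul] at key
  simp only [smul_add]
  rw [integral_add (hχ.integrable.smul_const _) (hχ.integrable_smul hP), integral_smul_const,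
    sub_eq_iff_eq_add.1 key, smul_neg, smul_add]
  abel

end WeakDerivative

section WeakSolutions

lemma eq_zero_of_convexOn_of_integrable {N : ℝ → ℝ} (hN : ConvexOn ℝ univ N)
    (hN0 : ∀ x, 0 ≤ N x) (hi : Integrable N) (x : ℝ) : N x = 0 := by
  have hmid : ∀ t, N x ≤ 1 / 2 * N (x + t) + 1 / 2 * N (x - t) := fun t => by
    have := hN.2 (mem_univ (x + t)) (mem_univ (x - t)) one_half_pos.le one_half_pos.le
      (add_halves 1)
    simpa only [smul_eq_mul, show 1 / 2 * (x + t) + 1 / 2 * (x - t) = x by ring] using this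
  have hconst : Integrable fun _ : ℝ => N x :=
    (((hi.comp_add_left x).const_mul (1 / 2)).add ((hi.comp_sub_left x).const_mul (1 / 2))).mono'
      aestronglyMeasurable_const
      (ae_of_all _ fun t => (Real.norm_of_nonneg (hN0 x)).trans_le (hmid t))
  exact (integrable_const_iff.1 hconst).resolve_right fun h =>
    absurd h.measure_univ_lt_top (by simp)

lemma convexOn_norm_sq_of_inner_nonneg {E : Type*} [NormedAddCommGroup E] [InnerProductSpace ℝ E]
    {F F₁ F₂ : ℝ → E} (hF : ∀ x, HasDerivAt F (F₁ x) x) (hF₁ : ∀ x, HasDerivAt F₁ (F₂ x) x)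
    (hF₂ : ∀ x, 0 ≤ inner ℝ (F x) (F₂ x)) : ConvexOn ℝ univ fun x => ‖F x‖ ^ 2 := by
  have hd : ∀ x, HasDerivAt (fun x => ‖F x‖ ^ 2) (2 * inner ℝ (F x) (F₁ x)) x := fun x =>
    (hF x).norm_sq
  have hd' : ∀ x, HasDerivAt (fun x => 2 * inner ℝ (F x) (F₁ x))
      (2 * (inner ℝ (F x) (F₂ x) + inner ℝ (F₁ x) (F₁ x))) x := fun x =>
    ((hF x).inner ℝ (hF₁ x)).const_mul 2
  refine Monotone.convexOn_univ_of_deriv (fun x => (hd x).differentiableAt) ?_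
  rw [show deriv (fun x => ‖F x‖ ^ 2) = _ from funext fun x => (hd x).deriv]
  refine monotone_of_deriv_nonneg (fun x => (hd' x).differentiableAt) fun x => ?_
  rw [(hd' x).deriv]
  exact mul_nonneg two_pos.le (add_nonneg (hF₂ x) real_inner_self_nonneg)

lemma exists_strong_solution {f q : ℝ → ℂ} (hf : LocallyIntegrable f) (hq : Continuous q)
    (w : ∀ φ : ℝ → ℝ, IsTestFunction φ →
      ∫ x, deriv (deriv φ) x • f x = ∫ x, φ x • (q x * f x)) :
    ∃ F F₁ : ℝ → ℂ, (∀ᵐ x, f x = F x) ∧ (∀ x, HasDerivAt F (F₁ x) x) ∧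
      ∀ x, HasDerivAt F₁ (q x * F x) x := by
  have hqf : LocallyIntegrable fun x => q x * f x := hf.continuous_mul hq
  obtain ⟨B, hB⟩ := exists_hasWeakDeriv_add_intervalIntegral hf hqf w
  have cF₁ := (continuous_intervalIntegral hqf 0).const_add B
  obtain ⟨A, hA⟩ := hB.exists_ae_eq_add_intervalIntegral hf cF₁.locallyIntegrable
  have hF := fun x => (hasDerivAt_intervalIntegral cF₁ 0 x).const_add A
  refine ⟨_, _, hA, hF, fun x => ?_⟩
  have cF : Continuous _ := continuous_iff_continuousAt.2 fun x => (hF x).continuousAt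
  refine ((hasDerivAt_intervalIntegral (hq.mul cF) 0 x).const_add B).congr_of_eventuallyEq
    (Eventually.of_forall fun t => congrArg (B + ·) ?_)
  refine intervalIntegral.integral_congr_ae ?_
  filter_upwards [hA] with s hs _
  simp [hs]

theorem ae_eq_zero_of_weak_solution {f : ℝ → ℂ} {Q : ℝ → ℝ} (hf : MemLp f 2) (hQ : Continuous Q)
    (w : ∀ φ : ℝ → ℝ, IsTestFunction φ →
      ∫ x, deriv (deriv φ) x • f x = ∫ x, φ x • (Complex.I * Q x * f x)) :
    ∀ᵐ x, f x = 0 := by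
  obtain ⟨F, F₁, hfF, hF, hF₁⟩ := exists_strong_solution (hf.locallyIntegrable one_le_two)
    (continuous_const.mul (Complex.continuous_ofReal.comp hQ)) w
  have hconvex := convexOn_norm_sq_of_inner_nonneg hF hF₁ fun x => by
    simp [Complex.inner, mul_left_comm, mul_comm]
  have hint : Integrable fun x => ‖F x‖ ^ 2 := (hf.integrable_norm_pow two_ne_zero).congr <| by
    filter_upwards [hfF] with x hx
    rw [hx]
  filter_upwards [hfF] with x hx
  simpa [hx] using eq_zero_of_convexOn_of_integrable hconvex (fun x => sq_nonneg _) hint x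

end WeakSolutions

section NeumannTestFunctions

variable {Ω : Opens ℝ} {s L : ℝ}

/-- Smooth compactly supported functions on the line satisfying the Neumann condition on `∂Ω`;
their restrictions to `Ω` form a core large enough to determine weak solutions. -/
structure IsNeumannTest {E : Type*} [NormedAddCommGroup E] [NormedSpace ℝ E] (Ω : Opens ℝ)
    (G : ℝ → E) : Prop extends IsTestFunction G where
  deriv_eq_zero : ∀ y ∈ frontier (Ω : Set ℝ), deriv G y = 0

/-- `Ω` is the open half-line with endpoint `L` in the direction `s = ±1`. -/
structure IsHalfLine (Ω : Opens ℝ) (s L : ℝ) : Prop where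
  sign : s = 1 ∨ s = -1
  coe_eq : (Ω : Set ℝ) = {x | 0 < s * (x - L)}

/-- The domains of the theorem: the whole line and open half-lines. -/
def IsLineOrHalfLine (Ω : Opens ℝ) : Prop :=
  (Ω : Set ℝ) = univ ∨ ∃ s L, IsHalfLine Ω s L

lemma isLineOrHalfLine_of_eq (hΩ : (Ω : Set ℝ) = univ ∨ (∃ L₁ : ℝ, (Ω : Set ℝ) = Iio L₁) ∨
    ∃ L₂ : ℝ, (Ω : Set ℝ) = Ioi L₂) : IsLineOrHalfLine Ω := by
  rcases hΩ with h | ⟨L, h⟩ | ⟨L, h⟩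
  · exact Or.inl h
  · exact Or.inr ⟨-1, L, Or.inr rfl, h.trans (by ext x; simp)⟩
  · exact Or.inr ⟨1, L, Or.inl rfl, h.trans (by ext x; simp)⟩

namespace IsHalfLine

lemma mul_self (h : IsHalfLine Ω s L) : s * s = 1 := by
  rcases h.sign with rfl | rfl <;> norm_num

lemma abs_eq (h : IsHalfLine Ω s L) : |s| = 1 := by
  rcases h.sign with rfl | rfl <;> norm_num

lemma mem_iff (h : IsHalfLine Ω s L) {x : ℝ} : x ∈ (Ω : Set ℝ) ↔ 0 < s * (x - L) := by
  rw [h.coe_eq, mem_ofPred_eq]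

lemma abs_sub_eq (h : IsHalfLine Ω s L) {x : ℝ} (hx : x ∈ (Ω : Set ℝ)) :
    |x - L| = s * (x - L) := by
  rw [← abs_of_pos (h.mem_iff.1 hx), abs_mul, h.abs_eq, one_mul]

lemma eq_Ioi_or_Iio (h : IsHalfLine Ω s L) :
    (s = 1 ∧ (Ω : Set ℝ) = Ioi L) ∨ (s = -1 ∧ (Ω : Set ℝ) = Iio L) := by
  have hcoe := h.coe_eq
  rcases h.sign with rfl | rfl
  · exact Or.inl ⟨rfl, hcoe.trans (by ext x; simp)⟩
  · exact Or.inr ⟨rfl, hcoe.trans (by ext x; simp)⟩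

lemma mem_closure_iff (h : IsHalfLine Ω s L) {x : ℝ} :
    x ∈ closure (Ω : Set ℝ) ↔ 0 ≤ s * (x - L) := by
  rcases h.eq_Ioi_or_Iio with ⟨rfl, hΩ⟩ | ⟨rfl, hΩ⟩ <;> simp [hΩ]

lemma frontier_eq (h : IsHalfLine Ω s L) : frontier (Ω : Set ℝ) = {L} := by
  rcases h.eq_Ioi_or_Iio with ⟨-, hΩ⟩ | ⟨-, hΩ⟩ <;> simp [hΩ]

lemma reflect_notMem (h : IsHalfLine Ω s L) {x : ℝ} (hx : x ∈ (Ω : Set ℝ)) :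
    2 * L - x ∉ (Ω : Set ℝ) := by
  rw [h.mem_iff] at hx ⊢
  linarith

lemma reflect_mem (h : IsHalfLine Ω s L) {x : ℝ} (hx : x ∉ (Ω : Set ℝ)) (hxL : x ≠ L) :
    2 * L - x ∈ (Ω : Set ℝ) := by
  have hs : s ≠ 0 := left_ne_zero_of_mul_eq_one h.mul_self
  rw [h.mem_iff, not_lt] at hx
  rw [h.mem_iff]
  linarith [hx.lt_of_ne (mul_ne_zero hs (sub_ne_zero.2 hxL))]

end IsHalfLine

lemma IsLineOrHalfLine.uniqueDiffOn_closure (hΩ : IsLineOrHalfLine Ω) :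
    UniqueDiffOn ℝ (closure (Ω : Set ℝ)) := by
  rcases hΩ with h | ⟨s, L, h⟩
  · simp [h, uniqueDiffOn_univ]
  · rcases h.eq_Ioi_or_Iio with ⟨-, hΩ⟩ | ⟨-, hΩ⟩
    · simpa [hΩ] using uniqueDiffOn_Ici L
    · simpa [hΩ] using uniqueDiffOn_Iic L

end NeumannTestFunctions

section Reflection

variable {Ω : Opens ℝ} {s L : ℝ} {E : Type*} [NormedAddCommGroup E] [NormedSpace ℝ E]

/-- The map folding the line onto the closed half-line with endpoint `L` in the direction `s`;
composition with it is the even extension across `L`. -/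
def fold (s L x : ℝ) : ℝ := L + s * |x - L|

lemma continuous_fold (s L : ℝ) : Continuous (fold s L) := by
  unfold fold
  fun_prop

lemma fold_reflect (s L x : ℝ) : fold s L (2 * L - x) = fold s L x := by
  rw [fold, fold, show 2 * L - x - L = -(x - L) by ring, abs_neg]

lemma IsHalfLine.fold_mem_closure (h : IsHalfLine Ω s L) (x : ℝ) :
    fold s L x ∈ closure (Ω : Set ℝ) := by
  rw [h.mem_closure_iff, fold, add_sub_cancel_left, ← mul_assoc, h.mul_self, one_mul]
  exact abs_nonneg _

lemma IsHalfLine.fold_eq_self (h : IsHalfLine Ω s L) {x : ℝ} (hx : x ∈ (Ω : Set ℝ)) :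
    fold s L x = x := by
  rw [fold, h.abs_sub_eq hx, ← mul_assoc, h.mul_self, one_mul, add_sub_cancel]

omit [NormedSpace ℝ E] in
lemma IsHalfLine.memLp_comp_fold (h : IsHalfLine Ω s L) {f : ℝ → E} {p : ℝ≥0∞}
    (hf : MemLp f p (volume.restrict (Ω : Set ℝ))) : MemLp (f ∘ fold s L) p := by
  have hind : MemLp ((Ω : Set ℝ).indicator f) p :=
    (memLp_indicator_iff_restrict Ω.isOpen.measurableSet).2 hf
  have hreflect := hind.comp_measurePreserving
    (Measure.measurePreserving_sub_left volume (2 * L))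
  refine (memLp_congr_ae ?_).1 (hind.add hreflect)
  filter_upwards [volume.ae_ne L] with x hxL
  by_cases hx : x ∈ (Ω : Set ℝ)
  · simp [hx, h.reflect_notMem hx, h.fold_eq_self hx]
  · have hx' := h.reflect_mem hx hxL
    simp [hx, hx', ← fold_reflect s L x, h.fold_eq_self hx']

lemma IsHalfLine.integral_eq_setIntegral_add_reflect (h : IsHalfLine Ω s L) {u : ℝ → E}
    (hu : Integrable u) : ∫ x, u x = ∫ x in (Ω : Set ℝ), (u x + u (2 * L - x)) := by
  have hreflect := Measure.measurePreserving_sub_left volume (2 * L)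
  have hcompl : ((Ω : Set ℝ)ᶜ : Set ℝ) =ᵐ[volume] (fun x => 2 * L - x) ⁻¹' (Ω : Set ℝ) := by
    filter_upwards [volume.ae_ne L] with x hxL
    exact propext ⟨fun hx => h.reflect_mem hx hxL, fun hx hx' => h.reflect_notMem hx' hx⟩
  rw [← integral_add_compl Ω.isOpen.measurableSet hu, setIntegral_congr_set hcompl,
    integral_add hu.integrableOn (hu.comp_sub_left (2 * L)).integrableOn]
  congr 1
  simpa using hreflect.setIntegral_preimage_emb (Homeomorph.subLeft (2 * L)).measurableEmbedding
    (fun x => u (2 * L - x)) (Ω : Set ℝ)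

lemma IsHalfLine.integral_smul_comp_fold (h : IsHalfLine Ω s L) {ψ : ℝ → ℝ}
    (hψ : IsTestFunction ψ) {g : ℝ → E} (hg : LocallyIntegrable (g ∘ fold s L)) :
    ∫ x, ψ x • g (fold s L x) = ∫ x in (Ω : Set ℝ), (ψ x + ψ (2 * L - x)) • g x := by
  refine (h.integral_eq_setIntegral_add_reflect (hψ.integrable_smul hg)).trans ?_
  refine setIntegral_congr_fun Ω.isOpen.measurableSet fun x hx => ?_
  simp only [Function.comp_apply, fold_reflect, h.fold_eq_self hx, add_smul]

lemma deriv_add_reflect {φ : ℝ → E} (hφ : Differentiable ℝ φ) (a : ℝ) :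
    deriv (fun x => φ x + φ (a - x)) = fun x => deriv φ x - deriv φ (a - x) := funext fun x => by
  rw [deriv_fun_add (hφ x) (by fun_prop), deriv_comp_const_sub, ← sub_eq_add_neg]

lemma deriv_sub_reflect {φ : ℝ → E} (hφ : Differentiable ℝ φ) (a : ℝ) :
    deriv (fun x => φ x - φ (a - x)) = fun x => deriv φ x + deriv φ (a - x) := funext fun x => by
  rw [deriv_fun_sub (hφ x) (by fun_prop), deriv_comp_const_sub, sub_neg_eq_add]

lemma IsHalfLine.isNeumannTest_add_reflect (h : IsHalfLine Ω s L) {φ : ℝ → E}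
    (hφ : IsTestFunction φ) : IsNeumannTest Ω fun x => φ x + φ (2 * L - x) where
  contDiff := hφ.contDiff.add (hφ.contDiff.comp (contDiff_const.sub contDiff_id))
  hasCompactSupport := hφ.hasCompactSupport.add
    (hφ.hasCompactSupport.comp_homeomorph (Homeomorph.subLeft (2 * L)))
  deriv_eq_zero y hy := by
    rw [h.frontier_eq, mem_singleton_iff] at hy
    rw [deriv_add_reflect hφ.differentiable, hy]
    simp [two_mul]

theorem ae_eq_zero_of_weak_neumann_solution (hΩ : IsLineOrHalfLine Ω) {f : ℝ → ℂ} {Q : ℝ → ℝ}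
    (hf : MemLp f 2 (volume.restrict (Ω : Set ℝ)))
    (hQ : ContinuousOn Q (closure (Ω : Set ℝ)))
    (w : ∀ φ : ℝ → ℝ, IsNeumannTest Ω φ → ∫ x in (Ω : Set ℝ), deriv (deriv φ) x • f x =
      ∫ x in (Ω : Set ℝ), φ x • (Complex.I * Q x * f x)) :
    f =ᵐ[volume.restrict (Ω : Set ℝ)] 0 := by
  rcases hΩ with hΩ | ⟨s, L, h⟩
  · rw [hΩ, closure_univ, continuousOn_univ] at hQ
    simp only [hΩ, Measure.restrict_univ] at hf w ⊢
    exact ae_eq_zero_of_weak_solution hf hQ fun φ hφ => w φ ⟨hφ, by simp [hΩ]⟩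
  · have hfold := h.memLp_comp_fold hf
    have hQfold : Continuous fun x => Complex.I * (Q (fold s L x) : ℂ) :=
      continuous_const.mul (Complex.continuous_ofReal.comp
        (hQ.comp_continuous (continuous_fold s L) h.fold_mem_closure))
    have hloc := hfold.locallyIntegrable one_le_two
    have hzero : ∀ᵐ x, f (fold s L x) = 0 := by
      refine ae_eq_zero_of_weak_solution (Q := fun x => Q (fold s L x)) hfold
        (hQ.comp_continuous (continuous_fold s L) h.fold_mem_closure) fun φ hφ => ?_
      have hw := w _ (h.isNeumannTest_add_reflect hφ)
      rw [deriv_add_reflect hφ.differentiable, deriv_sub_reflect hφ.deriv.differentiable] at hw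
      exact (h.integral_smul_comp_fold hφ.deriv.deriv hloc).trans <| hw.trans
        (h.integral_smul_comp_fold (g := fun x => Complex.I * Q x * f x) hφ
          (hloc.continuous_mul hQfold)).symm
    filter_upwards [ae_restrict_of_ae hzero, ae_restrict_mem Ω.isOpen.measurableSet] with x hx hxΩ
    rwa [h.fold_eq_self hxΩ] at hx

end Reflection

section Green

variable {Ω : Opens ℝ} {s L : ℝ}

lemma deriv_smoothTransition_eq_zero {x : ℝ} (hx : x ∉ Icc (0 : ℝ) 1) :
    deriv Real.smoothTransition x = 0 := by
  rcases lt_or_ge x 0 with h | h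
  · have heq : Real.smoothTransition =ᶠ[𝓝 x] fun _ => 0 := by
      filter_upwards [Iio_mem_nhds h] with y hy using Real.smoothTransition.zero_of_nonpos hy.le
    rw [heq.deriv_eq, deriv_const]
  · have heq : Real.smoothTransition =ᶠ[𝓝 x] fun _ => 1 := by
      filter_upwards [Ioi_mem_nhds (lt_of_not_ge fun h₁ => hx ⟨h, h₁⟩)] with y hy using
        Real.smoothTransition.one_of_one_le hy.le
    rw [heq.deriv_eq, deriv_const]

lemma exists_abs_deriv_smoothTransition_le :
    ∃ C : ℝ, ∀ x, |deriv Real.smoothTransition x| ≤ C :=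
  (HasCompactSupport.intro isCompact_Icc fun _ => deriv_smoothTransition_eq_zero
    ).exists_bound_of_continuous (Real.smoothTransition.contDiff (n := 1)).continuous_deriv_one

/-- A smooth function vanishing within distance `1 / n` of the endpoint `L` of a half-line in the
direction `s = ±1`, and equal to one at distance at least `2 / n` from it. -/
def cutoff (s L : ℝ) (n : ℕ) (x : ℝ) : ℝ := Real.smoothTransition (n * (s * (x - L)) - 1)

lemma contDiff_cutoff (s L : ℝ) (n : ℕ) : ContDiff ℝ ∞ (cutoff s L n) :=
  (Real.smoothTransition.contDiff (n := ⊤)).comp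
    (g := Real.smoothTransition) (f := fun x : ℝ => n * (s * (x - L)) - 1) (by fun_prop)

lemma continuous_deriv_cutoff (s L : ℝ) (n : ℕ) : Continuous (deriv (cutoff s L n)) :=
  (contDiff_cutoff s L n).continuous_deriv (by simp)

lemma deriv_cutoff (s L : ℝ) (n : ℕ) (x : ℝ) : deriv (cutoff s L n) x =
    deriv Real.smoothTransition (n * (s * (x - L)) - 1) * (n * s) := by
  have houter : DifferentiableAt ℝ Real.smoothTransition (n * (s * (x - L)) - 1) :=
    (Real.smoothTransition.contDiff (n := 1)).differentiable one_ne_zero _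
  have hinner : HasDerivAt (fun y : ℝ => (n : ℝ) * (s * (y - L)) - 1) (n * s) x := by
    simpa using ((((hasDerivAt_id x).sub_const L).const_mul s).const_mul (n : ℝ)).sub_const 1
  exact (houter.hasDerivAt.comp x hinner).deriv

lemma abs_cutoff_le_one (s L : ℝ) (n : ℕ) (x : ℝ) : |cutoff s L n x| ≤ 1 := by
  rw [cutoff, abs_of_nonneg (Real.smoothTransition.nonneg _)]
  exact Real.smoothTransition.le_one _

lemma tendsto_cutoff {x : ℝ} (hx : 0 < s * (x - L)) :
    Tendsto (fun n => cutoff s L n x) atTop (𝓝 1) := by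
  have h : Tendsto (fun n : ℕ => (n : ℝ) * (s * (x - L))) atTop atTop :=
    tendsto_natCast_atTop_atTop.atTop_mul_const hx
  refine tendsto_const_nhds.congr' ?_
  filter_upwards [h.eventually_ge_atTop 2] with n hn
  exact (Real.smoothTransition.one_of_one_le (by linarith)).symm

lemma IsHalfLine.tsupport_cutoff_subset (h : IsHalfLine Ω s L) (n : ℕ) :
    tsupport (cutoff s L n) ⊆ (Ω : Set ℝ) := by
  have hclosed : IsClosed {x : ℝ | 1 ≤ n * (s * (x - L))} :=
    isClosed_le continuous_const (by fun_prop)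
  refine (closure_minimal (fun x hx => ?_) hclosed).trans fun x hx => ?_
  · by_contra hlt
    rw [mem_ofPred_eq, not_le] at hlt
    exact hx (Real.smoothTransition.zero_of_nonpos (by linarith))
  · rw [mem_ofPred_eq] at hx
    rw [h.mem_iff]
    exact pos_of_mul_pos_right (zero_lt_one.trans_le hx) n.cast_nonneg

lemma IsHalfLine.abs_deriv_cutoff_le (h : IsHalfLine Ω s L) {C : ℝ}
    (hC : ∀ x, |deriv Real.smoothTransition x| ≤ C) (n : ℕ) (x : ℝ) :
    |deriv (cutoff s L n) x| ≤ C * n := by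
  rw [deriv_cutoff, abs_mul, abs_mul, h.abs_eq, mul_one, Nat.abs_cast]
  exact mul_le_mul_of_nonneg_right (hC _) n.cast_nonneg

lemma IsHalfLine.deriv_cutoff_eq_zero (h : IsHalfLine Ω s L) {n : ℕ} (hn : 0 < n) {x : ℝ}
    (hx : x ∈ (Ω : Set ℝ)) (hball : x ∉ Metric.closedBall L (2 / n)) :
    deriv (cutoff s L n) x = 0 := by
  rw [Metric.mem_closedBall, Real.dist_eq, h.abs_sub_eq hx, not_le,
    div_lt_iff₀' (Nat.cast_pos.2 hn)] at hball
  rw [deriv_cutoff, deriv_smoothTransition_eq_zero (fun hmem => by linarith [hmem.2]), zero_mul]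

lemma IsHalfLine.tendsto_integral_mul_cutoff (h : IsHalfLine Ω s L) (w : X Ω) {ψ : ℝ → ℝ}
    (hψ : IsTestFunction ψ) :
    Tendsto (fun n => ∫ x in (Ω : Set ℝ), (ψ x * cutoff s L n x) • w x) atTop
      (𝓝 (∫ x in (Ω : Set ℝ), ψ x • w x)) := by
  refine tendsto_integral_of_dominated_convergence (fun x => ‖ψ x • w x‖) (fun n => ?_)
    (integrable_smul_of_test w hψ.continuous hψ.hasCompactSupport).norm
    (fun n => ae_of_all _ fun x => ?_) ?_
  · exact ((hψ.continuous.mul (contDiff_cutoff s L n).continuous).aestronglyMeasurable).smul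
      (Lp.aestronglyMeasurable w)
  · rw [norm_smul, norm_smul, norm_mul]
    gcongr
    exact mul_le_of_le_one_right (norm_nonneg _) (abs_cutoff_le_one s L n x)
  · filter_upwards [ae_restrict_mem Ω.isOpen.measurableSet] with x hx
    simpa using ((tendsto_cutoff (h.mem_iff.1 hx)).const_mul (ψ x)).smul_const (w x)

lemma IsHalfLine.norm_integral_mul_deriv_cutoff_le (h : IsHalfLine Ω s L) {C : ℝ}
    (hC : ∀ x, |deriv Real.smoothTransition x| ≤ C) {n : ℕ} (hn : 0 < n) (w : X Ω) {ψ : ℝ → ℝ}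
    (hψ : IsTestFunction ψ) :
    ‖∫ x in (Ω : Set ℝ), (ψ x * deriv (cutoff s L n) x) • w x‖ ≤
      C * (n * ∫ x in Metric.closedBall L (2 / n), ‖ψ x • w x‖ ∂volume.restrict (Ω : Set ℝ)) := by
  have hint := (integrable_smul_of_test w hψ.continuous hψ.hasCompactSupport).norm
  rw [← mul_assoc, ← integral_const_mul,
    ← integral_indicator Metric.isClosed_closedBall.measurableSet]
  refine norm_integral_le_of_norm_le
    ((hint.const_mul _).indicator Metric.isClosed_closedBall.measurableSet) ?_
  filter_upwards [ae_restrict_mem Ω.isOpen.measurableSet] with x hx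
  by_cases hball : x ∈ Metric.closedBall L (2 / n)
  · rw [indicator_of_mem hball, mul_comm (ψ x), mul_smul, norm_smul]
    gcongr
    exact h.abs_deriv_cutoff_le hC n x
  · rw [indicator_of_notMem hball, h.deriv_cutoff_eq_zero hn hx hball, mul_zero, zero_smul,
      norm_zero]

lemma IsHalfLine.tendsto_integral_mul_deriv_cutoff (h : IsHalfLine Ω s L) (w : X Ω) {ψ : ℝ → ℝ}
    (hψ : IsTestFunction ψ)
    (hlayer : Tendsto (fun n : ℕ => n * ∫ x in Metric.closedBall L (2 / n), ‖ψ x • w x‖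
      ∂volume.restrict (Ω : Set ℝ)) atTop (𝓝 0)) :
    Tendsto (fun n => ∫ x in (Ω : Set ℝ), (ψ x * deriv (cutoff s L n) x) • w x) atTop (𝓝 0) := by
  obtain ⟨C, hC⟩ := exists_abs_deriv_smoothTransition_le
  refine squeeze_zero_norm' ?_ (by simpa only [mul_zero] using hlayer.const_mul C)
  filter_upwards [eventually_gt_atTop 0] with n hn
  exact h.norm_integral_mul_deriv_cutoff_le hC hn w hψ

lemma IsHalfLine.integral_deriv_smul (h : IsHalfLine Ω s L) {w w₁ : X Ω}
    (hw : IsWeakDeriv Ω w w₁) {ψ : ℝ → ℝ} (hψ : IsTestFunction ψ)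
    (hlayer : Tendsto (fun n : ℕ => n * ∫ x in Metric.closedBall L (2 / n), ‖ψ x • w x‖
      ∂volume.restrict (Ω : Set ℝ)) atTop (𝓝 0)) :
    ∫ x in (Ω : Set ℝ), deriv ψ x • w x = - ∫ x in (Ω : Set ℝ), ψ x • w₁ x := by
  have hlim := (h.tendsto_integral_mul_cutoff w hψ.deriv).add
    (h.tendsto_integral_mul_deriv_cutoff w hψ hlayer)
  rw [add_zero] at hlim
  refine tendsto_nhds_unique hlim ((h.tendsto_integral_mul_cutoff w₁ hψ).neg.congr fun n => ?_)
  have hη := contDiff_cutoff s L n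
  have hparts := hw (fun x => ψ x * cutoff s L n x) (hψ.contDiff.mul hη)
    hψ.hasCompactSupport.mul_right ((tsupport_mul_subset_right).trans (h.tsupport_cutoff_subset n))
  rw [← hparts]
  simp only [deriv_fun_mul (hψ.differentiable _) (hη.differentiable (by simp) _), add_smul]
  exact integral_add
    (integrable_smul_of_test w (hψ.deriv.continuous.mul hη.continuous)
      hψ.deriv.hasCompactSupport.mul_right)
    (integrable_smul_of_test w (hψ.continuous.mul (continuous_deriv_cutoff s L n))
      hψ.hasCompactSupport.mul_right)

lemma tendsto_volume_closedBall_two_div (L : ℝ) :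
    Tendsto (fun n : ℕ => volume (Metric.closedBall L (2 / n))) atTop (𝓝 0) := by
  have h : Tendsto (fun n : ℕ => 2 * ((2 : ℝ) / n)) atTop (𝓝 0) := by
    simpa using (tendsto_const_div_atTop_nhds_zero_nat (2 : ℝ)).const_mul 2
  simpa only [Real.volume_closedBall, ENNReal.ofReal_zero] using ENNReal.tendsto_ofReal h

lemma tendsto_setIntegral_closedBall_two_div {μ : Measure ℝ} (hμ : μ ≤ volume) {f : ℝ → ℝ}
    (hf : LocallyIntegrable f μ) (L : ℝ) :
    Tendsto (fun n : ℕ => ∫ x in Metric.closedBall L (2 / n), f x ∂μ) atTop (𝓝 0) := by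
  have hint : Integrable f (μ.restrict (Metric.closedBall L 2)) :=
    hf.integrableOn_isCompact (isCompact_closedBall L 2)
  have hvol : Tendsto (μ.restrict (Metric.closedBall L 2) ∘
      fun n : ℕ => Metric.closedBall L (2 / n)) atTop (𝓝 0) :=
    tendsto_of_tendsto_of_tendsto_of_le_of_le tendsto_const_nhds
      (tendsto_volume_closedBall_two_div L) (fun _ => zero_le)
      fun _ => Measure.le_iff'.1 (Measure.restrict_le_self.trans hμ) _
  refine (hint.tendsto_setIntegral_nhds_zero hvol).congr' ?_
  filter_upwards [eventually_ge_atTop 1] with n hn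
  rw [Measure.restrict_restrict_of_subset (Metric.closedBall_subset_closedBall
    (div_le_self zero_le_two (Nat.one_le_cast.2 hn)))]

lemma tendsto_boundary_layer_of_eq_zero (w : X Ω) {ψ : ℝ → ℝ} (hψ : IsTestFunction ψ)
    (h₀ : ψ L = 0) :
    Tendsto (fun n : ℕ => n * ∫ x in Metric.closedBall L (2 / n), ‖ψ x • w x‖
      ∂volume.restrict (Ω : Set ℝ)) atTop (𝓝 0) := by
  set μ := volume.restrict (Ω : Set ℝ)
  obtain ⟨D, hD⟩ := hψ.deriv.hasCompactSupport.exists_bound_of_continuous hψ.deriv.continuous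
  have hlip (x : ℝ) : |ψ x| ≤ D * |x - L| := by
    simpa [h₀] using convex_univ.norm_image_sub_le_of_norm_deriv_le
      (fun y _ => hψ.differentiable y) (fun y _ => hD y) (mem_univ L) (mem_univ x)
  have hw : LocallyIntegrable (fun x => ‖w x‖) μ :=
    (Lp.memLp w).norm.locallyIntegrable one_le_two
  refine squeeze_zero' (Eventually.of_forall fun n => by positivity) ?_
    (by simpa only [mul_zero] using
      (tendsto_setIntegral_closedBall_two_div Measure.restrict_le_self hw L).const_mul (2 * D))
  filter_upwards [eventually_gt_atTop 0] with n hn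
  have hn₀ : (n : ℝ) ≠ 0 := by positivity
  calc n * ∫ x in Metric.closedBall L (2 / n), ‖ψ x • w x‖ ∂μ
      ≤ n * ∫ x in Metric.closedBall L (2 / n), D * (2 / n) * ‖w x‖ ∂μ := by
        gcongr ?_ * ?_
        refine setIntegral_mono_on
          (integrable_smul_of_test w hψ.continuous hψ.hasCompactSupport).norm.integrableOn
          ((hw.integrableOn_isCompact (isCompact_closedBall _ _)).const_mul _)
          Metric.isClosed_closedBall.measurableSet fun x hx => ?_
        rw [norm_smul]
        gcongr
        exact (hlip x).trans (mul_le_mul_of_nonneg_left hx ((norm_nonneg _).trans (hD 0)))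
    _ = 2 * D * ∫ x in Metric.closedBall L (2 / n), ‖w x‖ ∂μ := by
        rw [integral_const_mul]
        field_simp

lemma HasZeroTrace.exists_norm_le (h : IsHalfLine Ω s L) {w : X Ω} (hw : HasZeroTrace Ω w) {ε : ℝ}
    (hε : 0 < ε) : ∃ r > 0, ∀ᵐ x ∂volume.restrict (Ω : Set ℝ), x ∈ Metric.ball L r → ‖w x‖ ≤ ε := by
  obtain ⟨u, hu, hwu, hu₀⟩ := hw
  have hL : L ∈ frontier (Ω : Set ℝ) := h.frontier_eq ▸ mem_singleton L
  obtain ⟨r, hr, hur⟩ := Metric.continuousOn_iff.1 hu L (frontier_subset_closure hL) ε hε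
  refine ⟨r, hr, ?_⟩
  filter_upwards [hwu, ae_restrict_mem Ω.isOpen.measurableSet] with x hx hxΩ hball
  rw [hx, ← dist_zero_right, ← hu₀ L hL]
  exact (hur x (subset_closure hxΩ) hball).le

lemma tendsto_boundary_layer_of_hasZeroTrace (h : IsHalfLine Ω s L) {w : X Ω}
    (hw : HasZeroTrace Ω w) {ψ : ℝ → ℝ} (hψ : IsTestFunction ψ) :
    Tendsto (fun n : ℕ => n * ∫ x in Metric.closedBall L (2 / n), ‖ψ x • w x‖
      ∂volume.restrict (Ω : Set ℝ)) atTop (𝓝 0) := by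
  obtain ⟨M, hM⟩ := hψ.hasCompactSupport.exists_bound_of_continuous hψ.continuous
  have hM₀ : 0 ≤ M := (norm_nonneg _).trans (hM 0)
  rw [Metric.tendsto_nhds]
  intro ε hε
  obtain ⟨r, hr, hwr⟩ := hw.exists_norm_le h (ε := ε / (4 * M + 1)) (by positivity)
  have hsmall : ∀ᶠ n : ℕ in atTop, (2 : ℝ) / n < r :=
    (tendsto_const_div_atTop_nhds_zero_nat 2).eventually_lt_const hr
  filter_upwards [hsmall, eventually_gt_atTop 0] with n hnr hn
  have : (0 : ℝ) < n := Nat.cast_pos.2 hn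
  have hbound : ∀ᵐ x ∂volume.restrict (Ω : Set ℝ), x ∈ Metric.closedBall L (2 / n) →
      ‖‖ψ x • w x‖‖ ≤ M * (ε / (4 * M + 1)) := by
    filter_upwards [hwr] with x hx hball
    rw [norm_norm, norm_smul]
    exact mul_le_mul (hM x) (hx (Metric.closedBall_subset_ball hnr hball)) (norm_nonneg _) hM₀
  have hvol : (volume.restrict (Ω : Set ℝ)).real (Metric.closedBall L (2 / n)) ≤ 4 / n :=
    (ENNReal.toReal_mono measure_closedBall_lt_top.ne (Measure.restrict_le_self _)).trans_eq <| by
      rw [← measureReal_def, Real.volume_real_closedBall (by positivity)]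
      ring
  rw [dist_zero_right, norm_mul, Real.norm_natCast]
  calc n * ‖∫ x in Metric.closedBall L (2 / n), ‖ψ x • w x‖ ∂volume.restrict (Ω : Set ℝ)‖
      ≤ n * (M * (ε / (4 * M + 1)) * (4 / n)) := by
        gcongr
        refine (norm_setIntegral_le_of_norm_le_const_ae' ?_ hbound).trans (by gcongr)
        exact (isCompact_closedBall L _).measure_lt_top
    _ = 4 * M / (4 * M + 1) * ε := by field_simp
    _ < ε := mul_lt_of_lt_one_left hε ((div_lt_one (by positivity)).2 (lt_add_one _))

theorem IsNeumannSecondDeriv.green_formula (hΩ : IsLineOrHalfLine Ω) {g g₂ : X Ω}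
    (hg : IsNeumannSecondDeriv Ω g g₂) {φ : ℝ → ℝ} (hφ : IsNeumannTest Ω φ) :
    ∫ x in (Ω : Set ℝ), φ x • g₂ x = ∫ x in (Ω : Set ℝ), deriv (deriv φ) x • g x := by
  obtain ⟨g₁, hg₁, htrace, hg₂⟩ := hg
  have hφ' := hφ.toIsTestFunction.deriv
  rcases hΩ with hΩ | ⟨s, L, h⟩
  · rw [hg₁ (deriv φ) hφ'.contDiff hφ'.hasCompactSupport (by simp [hΩ]),
      hg₂ φ hφ.contDiff hφ.hasCompactSupport (by simp [hΩ]), neg_neg]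
  · have hL : deriv φ L = 0 := hφ.deriv_eq_zero L (h.frontier_eq ▸ mem_singleton L)
    rw [h.integral_deriv_smul hg₁ hφ' (tendsto_boundary_layer_of_eq_zero g hφ' hL),
      h.integral_deriv_smul hg₂ hφ.toIsTestFunction
        (tendsto_boundary_layer_of_hasZeroTrace h htrace hφ.toIsTestFunction), neg_neg]

end Green

section ClosedOperators

variable {E : Type*} [NormedAddCommGroup E] [NormedSpace ℂ E] {A : E →ₗ.[ℂ] E} {z : ℂ} {c : ℝ}

lemma isClosable_of_forall_mem_closure_graph
    (h : ∀ x ∈ A.graph.topologicalClosure, x.1 = 0 → x.2 = 0) : A.IsClosable :=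
  ⟨A.graph.topologicalClosure.toLinearPMap,
    (Submodule.toLinearPMap_graph_eq A.graph.topologicalClosure h).symm⟩

lemma exists_closure_sub_smul_eq [CompleteSpace E] (hA : A.IsClosable) (hc : 0 < c)
    {D : Submodule ℂ A.domain} (hbound : ∀ g ∈ D, c * ‖(g : E)‖ ≤ ‖A g - z • (g : E)‖) {f : E}
    (hf : f ∈ (D.map (A.toFun - z • A.domain.subtype)).topologicalClosure) :
    ∃ u : A.closure.domain, A.closure u - z • (u : E) = f ∧ c * ‖(u : E)‖ ≤ ‖f‖ := by
  obtain ⟨x, hx, hxf⟩ := mem_closure_iff_seq_limit.1 hf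
  choose g hgD hgx using fun n => Submodule.mem_map.1 (hx n)
  have hAg : ∀ n, A (g n) - z • (g n : E) = x n := hgx
  have hdist : ∀ m n, dist (g m : E) (g n) ≤ c⁻¹ * dist (x m) (x n) := fun m n => by
    rw [inv_mul_eq_div, le_div_iff₀' hc, dist_eq_norm, dist_eq_norm, ← hAg, ← hAg,
      sub_sub_sub_comm, ← smul_sub, ← Submodule.coe_sub, ← LinearPMap.map_sub]
    exact hbound _ (D.sub_mem (hgD m) (hgD n))
  have hcauchy : CauchySeq fun n => (g n : E) := by
    rw [cauchySeq_iff_tendsto_dist_atTop_0]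
    have hx₀ := (cauchySeq_iff_tendsto_dist_atTop_0.1 hxf.cauchySeq).const_mul c⁻¹
    rw [mul_zero] at hx₀
    exact squeeze_zero (fun _ => dist_nonneg) (fun n => hdist n.1 n.2) hx₀
  obtain ⟨u, hu⟩ := cauchySeq_tendsto_of_complete hcauchy
  have hAu : Tendsto (fun n => A (g n)) atTop (𝓝 (f + z • u)) :=
    (hxf.add (hu.const_smul z)).congr fun n => by rw [← hAg n, sub_add_cancel]
  have hgraph : (u, f + z • u) ∈ A.closure.graph := by
    rw [← hA.graph_closure_eq_closure_graph]
    exact mem_closure_of_tendsto (hu.prodMk_nhds hAu) (Eventually.of_forall fun n => A.mem_graph _)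
  obtain ⟨w, rfl : (w : E) = u, hw⟩ := (LinearPMap.mem_graph_iff _).1 hgraph
  refine ⟨w, by rw [hw, add_sub_cancel_right], ?_⟩
  refine le_of_tendsto_of_tendsto' (hu.norm.const_mul c) hxf.norm fun n => ?_
  rw [← hAg n]
  exact hbound _ (hgD n)

lemma exists_isResolvent (hc : 0 < c) (hinj : ∀ g : A.domain, A g = z • (g : E) → (g : E) = 0)
    (hsolve : ∀ f, ∃ u : A.domain, A u - z • (u : E) = f ∧ c * ‖(u : E)‖ ≤ ‖f‖) :
    ∃ R : E →L[ℂ] E, IsResolvent A z R ∧ ‖R‖ ≤ c⁻¹ := by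
  let T : A.domain →ₗ[ℂ] E := A.toFun - z • A.domain.subtype
  have hT : Function.Injective T := by
    refine (injective_iff_map_eq_zero T).2 fun g hg => ?_
    exact Subtype.ext (hinj g (sub_eq_zero.1 hg))
  let e : A.domain ≃ₗ[ℂ] E :=
    LinearEquiv.ofBijective T ⟨hT, fun f => (hsolve f).imp fun _ h => h.1⟩
  have hbound : ∀ f, ‖(e.symm f : E)‖ ≤ c⁻¹ * ‖f‖ := fun f => by
    obtain ⟨u, rfl, hu⟩ := hsolve f
    rw [inv_mul_eq_div, le_div_iff₀' hc]
    exact (e.symm_apply_apply u).symm ▸ hu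
  refine ⟨(A.domain.subtype ∘ₗ e.symm.toLinearMap).mkContinuous c⁻¹ hbound,
    ⟨fun f => ⟨(e.symm f).2, e.apply_symm_apply f⟩, fun g => ?_⟩,
    LinearMap.mkContinuous_norm_le _ (by positivity) _⟩
  exact congrArg Subtype.val (e.symm_apply_apply g)

lemma exists_isResolvent_closure [CompleteSpace E] (hA : A.IsClosable) (hc : 0 < c)
    {D : Submodule ℂ A.domain} (hbound : ∀ g ∈ D, c * ‖(g : E)‖ ≤ ‖A g - z • (g : E)‖)
    (hdense : (D.map (A.toFun - z • A.domain.subtype)).topologicalClosure = ⊤)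
    (hinj : ∀ g : A.closure.domain, A.closure g = z • (g : E) → (g : E) = 0) :
    ∃ R : E →L[ℂ] E, IsResolvent A.closure z R ∧ ‖R‖ ≤ c⁻¹ :=
  exists_isResolvent hc hinj fun _ =>
    exists_closure_sub_smul_eq hA hc hbound (hdense ▸ Submodule.mem_top)

lemma le_pseudospectralAbscissa (hc : 0 < c)
    (h : ∀ s : ℝ, ∃ R : E →L[ℂ] E, IsResolvent A ((s : ℂ) * Complex.I) R ∧ ‖R‖ ≤ c⁻¹) :
    ENNReal.ofReal c ≤ pseudospectralAbscissa A := by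
  rw [pseudospectralAbscissa, ENNReal.le_inv_iff_le_inv, ← ENNReal.ofReal_inv_of_pos hc]
  refine iSup_le fun s => ?_
  obtain ⟨R, hR, hRc⟩ := h s
  refine (iInf₂_le R hR).trans ?_
  rw [← ofReal_norm]
  exact ENNReal.ofReal_le_ofReal hRc

end ClosedOperators

section TestFunctions

variable {Ω : Opens ℝ} {v : ℝ → ℝ}

lemma IsTestFunction.memLp {E : Type*} [NormedAddCommGroup E] [NormedSpace ℝ E] {G : ℝ → E}
    (hG : IsTestFunction G) (p : ℝ≥0∞) : MemLp G p (volume.restrict (Ω : Set ℝ)) :=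
  (hG.continuous.memLp_of_hasCompactSupport hG.hasCompactSupport).restrict _

lemma IsTestFunction.memLp_ofReal_mul {G : ℝ → ℂ} (hG : IsTestFunction G)
    (hv : ContinuousOn v (closure (Ω : Set ℝ))) (p : ℝ≥0∞) :
    MemLp (fun x => (v x : ℂ) * G x) p (volume.restrict (Ω : Set ℝ)) := by
  obtain ⟨M, hM⟩ := (hG.hasCompactSupport.isCompact.inter_left
    isClosed_closure).exists_bound_of_continuousOn (hv.mono inter_subset_left)
  refine (hG.memLp (Ω := Ω) p).of_le_mul (c := M) ?_ ?_
  · exact ((Complex.continuous_ofReal.comp_continuousOn (hv.mono subset_closure)).mul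
      hG.continuous.continuousOn).aestronglyMeasurable Ω.isOpen.measurableSet
  · filter_upwards [ae_restrict_mem Ω.isOpen.measurableSet] with x hx
    rw [norm_mul, Complex.norm_real]
    by_cases hxG : x ∈ tsupport G
    · exact mul_le_mul_of_nonneg_right (hM x ⟨subset_closure hx, hxG⟩) (norm_nonneg _)
    · rw [image_eq_zero_of_notMem_tsupport hxG, norm_zero, mul_zero, mul_zero]

lemma deriv_ofReal_comp {φ : ℝ → ℝ} (hφ : Differentiable ℝ φ) :
    deriv (fun x => (φ x : ℂ)) = fun x => ((deriv φ x : ℝ) : ℂ) :=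
  funext fun x => (hφ x).hasDerivAt.ofReal_comp.deriv

lemma deriv_deriv_ofReal_comp {φ : ℝ → ℝ} (hφ : IsTestFunction φ) :
    deriv (deriv fun x => (φ x : ℂ)) = fun x => ((deriv (deriv φ) x : ℝ) : ℂ) := by
  rw [deriv_ofReal_comp hφ.differentiable, deriv_ofReal_comp hφ.deriv.differentiable]

namespace IsNeumannTest

lemma ofReal {φ : ℝ → ℝ} (hφ : IsNeumannTest Ω φ) : IsNeumannTest Ω fun x => (φ x : ℂ) where
  contDiff := Complex.ofRealCLM.contDiff.comp hφ.contDiff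
  hasCompactSupport :=
    hφ.hasCompactSupport.comp_left (g := Complex.ofReal) Complex.ofReal_zero
  deriv_eq_zero y hy := by
    simp only [deriv_ofReal_comp hφ.differentiable, hφ.deriv_eq_zero y hy, Complex.ofReal_zero]

lemma add {G F : ℝ → ℂ} (hG : IsNeumannTest Ω G) (hF : IsNeumannTest Ω F) :
    IsNeumannTest Ω fun x => G x + F x where
  contDiff := hG.contDiff.add hF.contDiff
  hasCompactSupport := hG.hasCompactSupport.add hF.hasCompactSupport
  deriv_eq_zero y hy := by
    rw [deriv_fun_add (hG.differentiable y) (hF.differentiable y), hG.deriv_eq_zero y hy,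
      hF.deriv_eq_zero y hy, add_zero]

lemma const_mul {G : ℝ → ℂ} (hG : IsNeumannTest Ω G) (c : ℂ) :
    IsNeumannTest Ω fun x => c * G x where
  contDiff := contDiff_const.mul hG.contDiff
  hasCompactSupport := hG.hasCompactSupport.mul_left
  deriv_eq_zero y hy := by
    rw [deriv_const_mul c (hG.differentiable y), hG.deriv_eq_zero y hy, mul_zero]

lemma zero : IsNeumannTest Ω fun _ => (0 : ℂ) where
  contDiff := contDiff_const
  hasCompactSupport := HasCompactSupport.zero
  deriv_eq_zero y _ := deriv_const y 0

lemma of_tsupport_subset {φ : ℝ → ℝ} (hφ : IsTestFunction φ) (hs : tsupport φ ⊆ (Ω : Set ℝ)) :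
    IsNeumannTest Ω φ where
  toIsTestFunction := hφ
  deriv_eq_zero y hy := by
    rw [Ω.isOpen.frontier_eq] at hy
    exact image_eq_zero_of_notMem_tsupport fun h => hy.2 (hs (tsupport_deriv_subset h))

end IsNeumannTest

lemma hasWeakDeriv_deriv {E : Type*} [NormedAddCommGroup E] [NormedSpace ℝ E] {G : ℝ → E}
    (hG : ContDiff ℝ 1 G) : HasWeakDeriv G (deriv G) := fun _ hφ =>
  (neg_eq_iff_eq_neg.2 <| integral_bilinear_hasDerivAt_right_eq_neg_left_of_integrable
    (L := ContinuousLinearMap.lsmul ℝ ℝ) (fun x _ => (hφ.differentiable x).hasDerivAt)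
    (fun x _ => (hG.differentiable one_ne_zero x).hasDerivAt)
    (hφ.integrable_smul hG.continuous_deriv_one.locallyIntegrable)
    (hφ.deriv.integrable_smul hG.continuous.locallyIntegrable)
    (hφ.integrable_smul hG.continuous.locallyIntegrable)).symm

lemma setIntegral_smul_eq_integral {E : Type*} [NormedAddCommGroup E] [NormedSpace ℝ E]
    {φ : ℝ → ℝ} {S : Set ℝ} (hs : tsupport φ ⊆ S) (f : ℝ → E) :
    ∫ x in S, φ x • f x = ∫ x, φ x • f x :=
  setIntegral_eq_integral_of_forall_compl_eq_zero fun x hx => by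
    rw [image_eq_zero_of_notMem_tsupport fun h => hx (hs h), zero_smul]

lemma isWeakDeriv_of_ae_eq {g g₁ : X Ω} {G : ℝ → ℂ} (hG : ContDiff ℝ 1 G)
    (hg : g =ᵐ[volume.restrict (Ω : Set ℝ)] G)
    (hg₁ : g₁ =ᵐ[volume.restrict (Ω : Set ℝ)] deriv G) : IsWeakDeriv Ω g g₁ := by
  intro φ hφ hc hs
  rw [integral_congr_ae (hg.mono fun x hx => congrArg (deriv φ x • ·) hx),
    integral_congr_ae (hg₁.mono fun x hx => congrArg (φ x • ·) hx),
    setIntegral_smul_eq_integral (tsupport_deriv_subset.trans hs),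
    setIntegral_smul_eq_integral hs]
  exact hasWeakDeriv_deriv hG φ ⟨hφ, hc⟩

lemma isNeumannSecondDeriv_of_ae_eq {g g₂ : X Ω} {G : ℝ → ℂ} (hG : IsNeumannTest Ω G)
    (hg : g =ᵐ[volume.restrict (Ω : Set ℝ)] G)
    (hg₂ : g₂ =ᵐ[volume.restrict (Ω : Set ℝ)] deriv (deriv G)) : IsNeumannSecondDeriv Ω g g₂ := by
  have hG₁ : MemLp (deriv G) 2 (volume.restrict (Ω : Set ℝ)) := hG.toIsTestFunction.deriv.memLp 2
  exact ⟨hG₁.toLp _, isWeakDeriv_of_ae_eq (hG.contDiff.of_le (by simp)) hg hG₁.coeFn_toLp,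
    ⟨deriv G, hG.toIsTestFunction.deriv.continuous.continuousOn, hG₁.coeFn_toLp,
      hG.deriv_eq_zero⟩,
    isWeakDeriv_of_ae_eq (hG.toIsTestFunction.deriv.contDiff.of_le (by simp)) hG₁.coeFn_toLp hg₂⟩

lemma secondDeriv_ae_eq {g : neumannDomain Ω v} {G : ℝ → ℂ} (hG : IsNeumannTest Ω G)
    (hg : (g : X Ω) =ᵐ[volume.restrict (Ω : Set ℝ)] G) :
    secondDeriv g =ᵐ[volume.restrict (Ω : Set ℝ)] deriv (deriv G) := by
  have hG₂ : MemLp (deriv (deriv G)) 2 (volume.restrict (Ω : Set ℝ)) :=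
    hG.toIsTestFunction.deriv.deriv.memLp 2
  rw [(secondDeriv_spec g).unique (isNeumannSecondDeriv_of_ae_eq hG hg hG₂.coeFn_toLp)]
  exact hG₂.coeFn_toLp

/-- The elements of `neumannDomain` represented by Neumann test functions: the subspace on which
the resolvent estimate is proved classically. -/
def neumannTests (Ω : Opens ℝ) (v : ℝ → ℝ) : Submodule ℂ (neumannDomain Ω v) where
  carrier := {g | ∃ G : ℝ → ℂ, IsNeumannTest Ω G ∧ (g : X Ω) =ᵐ[volume.restrict (Ω : Set ℝ)] G}
  add_mem' := by
    rintro g h ⟨G, hG, hg⟩ ⟨F, hF, hh⟩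
    exact ⟨_, hG.add hF, (Lp.coeFn_add (g : X Ω) (h : X Ω)).trans (hg.add hh)⟩
  zero_mem' := ⟨_, IsNeumannTest.zero, Lp.coeFn_zero ℂ 2 _⟩
  smul_mem' := by
    rintro c g ⟨G, hG, hg⟩
    exact ⟨_, hG.const_mul c, (Lp.coeFn_smul c (g : X Ω)).trans (hg.const_smul c)⟩

lemma exists_mem_neumannTests (hv : ContinuousOn v (closure (Ω : Set ℝ))) {G : ℝ → ℂ}
    (hG : IsNeumannTest Ω G) :
    ∃ g ∈ neumannTests Ω v, (g : X Ω) =ᵐ[volume.restrict (Ω : Set ℝ)] G := by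
  have hG₀ : MemLp G 2 (volume.restrict (Ω : Set ℝ)) := hG.toIsTestFunction.memLp 2
  have hG₂ : MemLp (deriv (deriv G)) 2 (volume.restrict (Ω : Set ℝ)) :=
    hG.toIsTestFunction.deriv.deriv.memLp 2
  have hmem : hG₀.toLp G ∈ neumannDomain Ω v := by
    refine ⟨⟨_, isNeumannSecondDeriv_of_ae_eq hG hG₀.coeFn_toLp hG₂.coeFn_toLp⟩,
      (memLp_congr_ae ?_).2 (hG.toIsTestFunction.memLp_ofReal_mul hv 2)⟩
    filter_upwards [hG₀.coeFn_toLp] with x hx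
    rw [hx]
  exact ⟨⟨_, hmem⟩, ⟨G, hG, hG₀.coeFn_toLp⟩, hG₀.coeFn_toLp⟩

lemma operatorCore_apply (ν k : ℝ) (g : neumannDomain Ω v) :
    operatorCore Ω v ν k g = -((ν : ℂ) • secondDeriv g) + (Complex.I * k) • mulV g := rfl

lemma operatorCore_sub_smul_ae_eq {g : neumannDomain Ω v} {G : ℝ → ℂ} (hG : IsNeumannTest Ω G)
    (hg : (g : X Ω) =ᵐ[volume.restrict (Ω : Set ℝ)] G) (ν k s : ℝ) :
    (operatorCore Ω v ν k g - ((s : ℂ) * Complex.I) • (g : X Ω) : X Ω)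
      =ᵐ[volume.restrict (Ω : Set ℝ)] modelOp ν (fun x => k * v x - s) G := by
  rw [operatorCore_apply]
  filter_upwards [Lp.coeFn_sub (-((ν : ℂ) • secondDeriv g) + (Complex.I * (k : ℂ)) • mulV g)
      (((s : ℂ) * Complex.I) • (g : X Ω)),
    Lp.coeFn_add (-((ν : ℂ) • secondDeriv g)) ((Complex.I * (k : ℂ)) • mulV g),
    Lp.coeFn_neg ((ν : ℂ) • secondDeriv g), Lp.coeFn_smul (ν : ℂ) (secondDeriv g),
    Lp.coeFn_smul (Complex.I * (k : ℂ)) (mulV g), Lp.coeFn_smul ((s : ℂ) * Complex.I) (g : X Ω),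
    mulV_spec g, secondDeriv_ae_eq hG hg, hg] with x hsub hadd hneg hν hk hs hmul hderiv hgx
  simp only [hsub, hadd, hneg, hν, hk, hs, hmul, hderiv, hgx, modelOp, Pi.sub_apply, Pi.add_apply,
    Pi.neg_apply, Pi.smul_apply, smul_eq_mul]
  push_cast
  ring

end TestFunctions

section Adjoint

variable {Ω : Opens ℝ} {v : ℝ → ℝ} {ν k s : ℝ}

lemma inner_of_ae_eq_ofReal {p : X Ω} {φ : ℝ → ℝ}
    (hp : p =ᵐ[volume.restrict (Ω : Set ℝ)] fun x => (φ x : ℂ)) (f : X Ω) :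
    inner ℂ p f = ∫ x in (Ω : Set ℝ), φ x • f x := by
  rw [L2.inner_def]
  refine integral_congr_ae ?_
  filter_upwards [hp] with x hx
  rw [hx, RCLike.inner_apply, Complex.conj_ofReal, Complex.real_smul, mul_comm]

lemma inner_secondDeriv_right (hΩ : IsLineOrHalfLine Ω) {p : neumannDomain Ω v} {φ : ℝ → ℝ}
    (hφ : IsNeumannTest Ω φ)
    (hp : (p : X Ω) =ᵐ[volume.restrict (Ω : Set ℝ)] fun x => (φ x : ℂ)) (g : neumannDomain Ω v) :
    inner ℂ (p : X Ω) (secondDeriv g) = inner ℂ (secondDeriv p) (g : X Ω) := by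
  have hp₂ := secondDeriv_ae_eq hφ.ofReal hp
  rw [deriv_deriv_ofReal_comp hφ.toIsTestFunction] at hp₂
  rw [inner_of_ae_eq_ofReal hp, inner_of_ae_eq_ofReal hp₂]
  exact (secondDeriv_spec g).green_formula hΩ hφ

lemma inner_mulV_right (p g : neumannDomain Ω v) :
    inner ℂ (p : X Ω) (mulV g) = inner ℂ (mulV p) (g : X Ω) := by
  rw [L2.inner_def, L2.inner_def]
  refine integral_congr_ae ?_
  filter_upwards [mulV_spec g, mulV_spec p] with x hg hp
  rw [hg, hp, RCLike.inner_apply, RCLike.inner_apply, map_mul, Complex.conj_ofReal]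
  ring

lemma inner_operatorCore_right (hΩ : IsLineOrHalfLine Ω) {p : neumannDomain Ω v} {φ : ℝ → ℝ}
    (hφ : IsNeumannTest Ω φ)
    (hp : (p : X Ω) =ᵐ[volume.restrict (Ω : Set ℝ)] fun x => (φ x : ℂ)) (ν k : ℝ)
    (g : neumannDomain Ω v) :
    inner ℂ (p : X Ω) (operatorCore Ω v ν k g) =
      inner ℂ (operatorCore Ω v ν (-k) p) (g : X Ω) := by
  rw [operatorCore_apply, operatorCore_apply, inner_add_right, inner_add_left, inner_neg_right,
    inner_neg_left, inner_smul_right, inner_smul_left, inner_smul_right, inner_smul_left,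
    inner_secondDeriv_right hΩ hφ hp, inner_mulV_right]
  simp only [map_mul, map_neg, Complex.conj_I, Complex.conj_ofReal, Complex.ofReal_neg, neg_mul_neg]

lemma inner_of_mem_closure_graph (hΩ : IsLineOrHalfLine Ω) {p : neumannDomain Ω v} {φ : ℝ → ℝ}
    (hφ : IsNeumannTest Ω φ)
    (hp : (p : X Ω) =ᵐ[volume.restrict (Ω : Set ℝ)] fun x => (φ x : ℂ)) {y : X Ω × X Ω}
    (hy : y ∈ (operatorCore Ω v ν k).graph.topologicalClosure) :
    inner ℂ (p : X Ω) y.2 = inner ℂ (operatorCore Ω v ν (-k) p) y.1 := by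
  refine closure_minimal (t := {y : X Ω × X Ω | inner ℂ (p : X Ω) y.2 =
    inner ℂ (operatorCore Ω v ν (-k) p) y.1}) (fun y hy => ?_)
    (isClosed_eq (by fun_prop) (by fun_prop)) hy
  obtain ⟨g, hg, hAg⟩ := (LinearPMap.mem_graph_iff _).1 hy
  rw [mem_ofPred_eq, ← hg, ← hAg]
  exact inner_operatorCore_right hΩ hφ hp ν k g

lemma eq_zero_of_forall_integral_smul_eq_zero {f : X Ω}
    (h : ∀ φ : ℝ → ℝ, IsTestFunction φ → tsupport φ ⊆ (Ω : Set ℝ) →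
      ∫ x in (Ω : Set ℝ), φ x • f x = 0) : f = 0 := by
  have hf : LocallyIntegrableOn f (Ω : Set ℝ) :=
    locallyIntegrableOn_of_locallyIntegrable_restrict ((Lp.memLp f).locallyIntegrable one_le_two)
  refine (Lp.eq_zero_iff_ae_eq_zero).2 ((ae_restrict_iff' Ω.isOpen.measurableSet).2 ?_)
  refine Ω.isOpen.ae_eq_zero_of_integral_contDiff_smul_eq_zero hf fun φ hφ hc hs => ?_
  rw [← setIntegral_smul_eq_integral hs]
  exact h φ ⟨hφ, hc⟩ hs

lemma isClosable_operatorCore (hΩ : IsLineOrHalfLine Ω)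
    (hv : ContinuousOn v (closure (Ω : Set ℝ))) (ν k : ℝ) :
    (operatorCore Ω v ν k).IsClosable := by
  refine isClosable_of_forall_mem_closure_graph fun y hy hy₁ => ?_
  refine eq_zero_of_forall_integral_smul_eq_zero fun φ hφ hs => ?_
  have hφΩ : IsNeumannTest Ω φ := .of_tsupport_subset hφ hs
  obtain ⟨p, -, hp⟩ := exists_mem_neumannTests hv hφΩ.ofReal
  rw [← inner_of_ae_eq_ofReal hp, inner_of_mem_closure_graph hΩ hφΩ hp hy, hy₁, inner_zero_right]

lemma inner_operatorCore_sub_smul {p : neumannDomain Ω v} {φ : ℝ → ℝ} (hφ : IsNeumannTest Ω φ)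
    (hp : (p : X Ω) =ᵐ[volume.restrict (Ω : Set ℝ)] fun x => (φ x : ℂ)) (ν k s : ℝ) (f : X Ω) :
    inner ℂ (operatorCore Ω v ν k p - ((s : ℂ) * Complex.I) • (p : X Ω)) f =
      -(ν : ℂ) * (∫ x in (Ω : Set ℝ), deriv (deriv φ) x • f x) -
        ∫ x in (Ω : Set ℝ), φ x • (Complex.I * (k * v x - s : ℝ) * f x) := by
  have hae := operatorCore_sub_smul_ae_eq hφ.ofReal hp ν k s
  set q : X Ω := operatorCore Ω v ν k p - ((s : ℂ) * Complex.I) • (p : X Ω)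
  have hinner : (fun x => inner ℂ (q x) (f x)) =ᵐ[volume.restrict (Ω : Set ℝ)]
      fun x => -(ν : ℂ) * (deriv (deriv φ) x • f x) -
        φ x • (Complex.I * (k * v x - s : ℝ) * f x) := by
    filter_upwards [hae] with x hx
    rw [hx, modelOp, deriv_deriv_ofReal_comp hφ.toIsTestFunction, RCLike.inner_apply]
    simp only [Complex.real_smul, map_add, map_mul, map_neg, Complex.conj_ofReal, Complex.conj_I]
    ring
  have hint₂ : Integrable (fun x => -(ν : ℂ) * (deriv (deriv φ) x • f x))
      (volume.restrict (Ω : Set ℝ)) :=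
    (integrable_smul_of_test f hφ.toIsTestFunction.deriv.deriv.continuous
      hφ.toIsTestFunction.deriv.deriv.hasCompactSupport).const_mul _
  have hint₀ : Integrable (fun x => φ x • (Complex.I * (k * v x - s : ℝ) * f x))
      (volume.restrict (Ω : Set ℝ)) := by
    refine (hint₂.sub (L2.integrable_inner (𝕜 := ℂ) q f)).congr ?_
    filter_upwards [hinner] with x hx
    rw [Pi.sub_apply, hx, sub_sub_cancel]
  rw [L2.inner_def, integral_congr_ae hinner, integral_sub hint₂ hint₀, integral_const_mul]

lemma eq_zero_of_forall_inner_operatorCore_eq_zero (hΩ : IsLineOrHalfLine Ω)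
    (hv : ContinuousOn v (closure (Ω : Set ℝ))) (hν : ν ≠ 0) {f : X Ω}
    (hf : ∀ p ∈ neumannTests Ω v, ∀ φ : ℝ → ℝ, IsNeumannTest Ω φ →
      (p : X Ω) =ᵐ[volume.restrict (Ω : Set ℝ)] (fun x => (φ x : ℂ)) →
      inner ℂ (operatorCore Ω v ν k p - ((s : ℂ) * Complex.I) • (p : X Ω)) f = 0) : f = 0 := by
  refine (Lp.eq_zero_iff_ae_eq_zero).2 <|
    ae_eq_zero_of_weak_neumann_solution hΩ (Lp.memLp f) (Q := fun x => -(k * v x - s) / ν)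
    (((continuousOn_const.mul hv).sub continuousOn_const).neg.div_const ν) fun φ hφ => ?_
  obtain ⟨p, hp, hpφ⟩ := exists_mem_neumannTests hv hφ.ofReal
  have horth := hf p hp φ hφ hpφ
  rw [inner_operatorCore_sub_smul hφ hpφ, sub_eq_zero] at horth
  have hpotential : ∫ x in (Ω : Set ℝ), φ x • (Complex.I * ((-(k * v x - s) / ν : ℝ) : ℂ) * f x) =
      -(ν : ℂ)⁻¹ * ∫ x in (Ω : Set ℝ), φ x • (Complex.I * (k * v x - s : ℝ) * f x) := by
    rw [← integral_const_mul]
    refine integral_congr_ae (ae_of_all _ fun x => ?_)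
    simp only [Complex.real_smul]
    push_cast
    ring
  rw [hpotential, ← horth, ← mul_assoc, neg_mul_neg,
    inv_mul_cancel₀ (Complex.ofReal_ne_zero.2 hν), one_mul]

lemma topologicalClosure_map_neumannTests (hΩ : IsLineOrHalfLine Ω)
    (hv : ContinuousOn v (closure (Ω : Set ℝ))) (hν : ν ≠ 0) :
    ((neumannTests Ω v).map ((operatorCore Ω v ν k).toFun -
      ((s : ℂ) * Complex.I) • (operatorCore Ω v ν k).domain.subtype)).topologicalClosure = ⊤ := by
  rw [Submodule.topologicalClosure_eq_top_iff, Submodule.eq_bot_iff]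
  exact fun f hf => eq_zero_of_forall_inner_operatorCore_eq_zero hΩ hv hν fun p hp _ _ _ =>
    (Submodule.mem_orthogonal _ f).1 hf _ (Submodule.mem_map_of_mem hp)

lemma eq_zero_of_closure_eigenvector (hΩ : IsLineOrHalfLine Ω)
    (hv : ContinuousOn v (closure (Ω : Set ℝ))) (hν : ν ≠ 0)
    {g : (operatorCore Ω v ν k).closure.domain}
    (hg : (operatorCore Ω v ν k).closure g = ((s : ℂ) * Complex.I) • (g : X Ω)) :
    (g : X Ω) = 0 := by
  have hgraph : ((g : X Ω), ((s : ℂ) * Complex.I) • (g : X Ω)) ∈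
      (operatorCore Ω v ν k).graph.topologicalClosure := by
    rw [(isClosable_operatorCore hΩ hv ν k).graph_closure_eq_closure_graph, ← hg]
    exact LinearPMap.mem_graph _ g
  refine eq_zero_of_forall_inner_operatorCore_eq_zero (k := -k) (s := -s) hΩ hv hν
    fun p _ φ hφ hp => ?_
  have hadjoint := inner_of_mem_closure_graph hΩ hφ hp hgraph
  rw [inner_sub_left, ← hadjoint, inner_smul_left, inner_smul_right, map_mul,
    Complex.conj_ofReal, Complex.conj_I, Complex.ofReal_neg, neg_mul_neg, sub_self]

end Adjoint

section Resolvent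

variable {Ω : Opens ℝ} {v : ℝ → ℝ} {m : ℕ} {ν k l c δ : ℝ}

lemma norm_eq_sqrt_integral {g : X Ω} {G : ℝ → ℂ} (hg : g =ᵐ[volume.restrict (Ω : Set ℝ)] G) :
    ‖g‖ = √(∫ x in (Ω : Set ℝ), ‖G x‖ ^ 2) := by
  have hinner : inner ℂ g g = ((∫ x in (Ω : Set ℝ), ‖G x‖ ^ 2 : ℝ) : ℂ) := by
    rw [L2.inner_def, ← integral_complex_ofReal]
    refine integral_congr_ae ?_
    filter_upwards [hg] with x hx
    rw [hx, Complex.ofReal_pow]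
    exact inner_self_eq_norm_sq_to_K _
  rw [norm_eq_sqrt_re_inner (𝕜 := ℂ), hinner, RCLike.re_eq_complex_re, Complex.ofReal_re]

lemma exists_le_natCast_mul (hδ : 0 < δ) (r : ℝ) : ∃ N : ℕ, r ≤ N * δ :=
  (Archimedean.arch r hδ).imp fun N hN => by rwa [← nsmul_eq_mul]

lemma IsLineOrHalfLine.exists_filling_interval (hΩ : IsLineOrHalfLine Ω) (hδ : 0 < δ) (R : ℝ) :
    ∃ (a : ℝ) (N : ℕ), Icc a (a + N * δ) ⊆ closure (Ω : Set ℝ) ∧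
      Ioo a (a + N * δ) ⊆ (Ω : Set ℝ) ∧ (a ∈ frontier (Ω : Set ℝ) ∨ a ≤ -R) ∧
      (a + N * δ ∈ frontier (Ω : Set ℝ) ∨ R ≤ a + N * δ) ∧
      ∀ x ∈ (Ω : Set ℝ), x ∈ Ioo (-R) R → x ∈ Ioo a (a + N * δ) := by
  rcases hΩ with hΩ | ⟨s, L, h⟩
  · obtain ⟨N, hN⟩ := exists_le_natCast_mul hδ (2 * R)
    exact ⟨-R, N, by simp [hΩ], by simp [hΩ], Or.inr le_rfl, Or.inr (by linarith),
      fun x _ hx => ⟨hx.1, by linarith [hx.2]⟩⟩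
  have hL : L ∈ frontier (Ω : Set ℝ) := h.frontier_eq ▸ mem_singleton L
  rcases h.eq_Ioi_or_Iio with ⟨-, hΩ⟩ | ⟨-, hΩ⟩
  · obtain ⟨N, hN⟩ := exists_le_natCast_mul hδ (R - L)
    refine ⟨L, N, ?_, hΩ ▸ Ioo_subset_Ioi_self, Or.inl hL, Or.inr (by linarith),
      fun x hx hxR => ⟨hΩ.subset hx, by linarith [hxR.2]⟩⟩
    rw [hΩ, closure_Ioi]
    exact Icc_subset_Ici_self
  · obtain ⟨N, hN⟩ := exists_le_natCast_mul hδ (L + R)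
    refine ⟨L - N * δ, N, ?_⟩
    rw [sub_add_cancel]
    refine ⟨?_, hΩ ▸ Ioo_subset_Iio_self, Or.inr (by linarith), Or.inl hL,
      fun x hx hxR => ⟨by linarith [hxR.1], hΩ.subset hx⟩⟩
    rw [hΩ, closure_Iio]
    exact Icc_subset_Iic_self

lemma rate_pos (m : ℕ) (hν : 0 < ν) (hk : k ≠ 0) : 0 < rate m ν k := by
  have : 0 < |k| := abs_pos.2 hk
  rw [rate]
  split_ifs <;> positivity

lemma rate_abs_mul_pow (m : ℕ) (hk : k ≠ 0) (hδ : 0 < δ) (hδ1 : δ ≤ 1) :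
    rate m (|k| * δ ^ (m + 2)) k = |k| * δ ^ m := by
  have hk' : 0 < |k| := abs_pos.2 hk
  have hm : (m : ℝ) + 2 ≠ 0 := by positivity
  have hδm : (δ ^ (m + 2)) ^ ((m : ℝ) / (m + 2)) = δ ^ m := by
    rw [← Real.rpow_natCast, ← Real.rpow_mul hδ.le, Nat.cast_add, Nat.cast_two,
      mul_div_cancel₀ _ hm, Real.rpow_natCast]
  rw [rate, if_pos (mul_le_of_le_one_right hk'.le (pow_le_one₀ hδ.le hδ1)),
    Real.mul_rpow hk'.le (by positivity), hδm, mul_right_comm, ← Real.rpow_add hk', ← add_div,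
    div_self hm, Real.rpow_one]

lemma exists_pow_eq_of_le_one {q : ℝ} (hq : 0 < q) (hq1 : q ≤ 1) {n : ℕ} (hn : n ≠ 0) :
    ∃ δ : ℝ, 0 < δ ∧ δ ≤ 1 ∧ δ ^ n = q :=
  ⟨q ^ (n : ℝ)⁻¹, Real.rpow_pos_of_pos hq _, Real.rpow_le_one hq.le hq1 (by positivity),
    Real.rpow_inv_natCast_pow hq.le hn⟩

lemma exists_scale (m : ℕ) (hν : 0 < ν) (hk : k ≠ 0) :
    ∃ δ : ℝ, 0 < δ ∧ δ ≤ 1 ∧ rate m ν k ≤ |k| * δ ^ m ∧ δ ^ 2 * rate m ν k ≤ ν ∧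
      ν * rate m ν k ≤ (|k| * δ ^ (m + 1)) ^ 2 := by
  have hk' : 0 < |k| := abs_pos.2 hk
  rcases le_or_gt ν |k| with h | h
  · -- Diffusion balances mixing at the scale `ν / δ ^ 2 = |k| * δ ^ m`.
    obtain ⟨δ, hδ, hδ1, hpow⟩ := exists_pow_eq_of_le_one (div_pos hν hk') ((div_le_one hk').2 h)
      (Nat.succ_ne_zero (m + 1))
    obtain rfl : |k| * δ ^ (m + 2) = ν := by rw [hpow, mul_div_cancel₀ _ hk'.ne']
    rw [rate_abs_mul_pow m hk hδ hδ1]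
    exact ⟨δ, hδ, hδ1, le_rfl, le_of_eq (by ring), le_of_eq (by ring)⟩
  · have hrate : rate m ν k = |k| ^ 2 / ν := by rw [rate, if_neg h.not_ge, sq_abs]
    refine ⟨1, one_pos, le_rfl, ?_, ?_, ?_⟩
    · rw [hrate, one_pow, mul_one, div_le_iff₀ hν, sq]
      gcongr
    · rw [hrate, one_pow, one_mul, div_le_iff₀ hν, ← sq]
      gcongr
    · rw [hrate, one_pow, mul_one, mul_div_cancel₀ _ hν.ne']

/-- The constant `K` of `interval_estimate` for potentials leaving their levels with constants `l`
and `c`. -/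
def energyConst (l c : ℝ) : ℝ := 3 / (l * c) + 12 / (l ^ 2 * c)

/-- The constant of the resolvent estimate for potentials leaving their levels with constants `l`
and `c`. -/
def resolventConst (l c : ℝ) : ℝ := 2 * energyConst l c + energyConst l c ^ 2 + 4

lemma resolventConst_pos (hl : 0 < l) (hc : 0 < c) : 0 < resolventConst l c := by
  unfold resolventConst energyConst
  positivity

lemma le_energyConst_of_rate_le (hl : 0 < l) (hc : 0 < c) (hk : k ≠ 0) (hδ : 0 < δ) {r : ℝ}
    (hr : r ≤ |k| * δ ^ m) :
    3 * δ / (|k| * (c * δ ^ m) * (l * δ)) * r ≤ energyConst l c := by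
  have : 0 < |k| := abs_pos.2 hk
  calc 3 * δ / (|k| * (c * δ ^ m) * (l * δ)) * r
      ≤ 3 * δ / (|k| * (c * δ ^ m) * (l * δ)) * (|k| * δ ^ m) := by gcongr
    _ = 3 / (l * c) := by field_simp
    _ ≤ energyConst l c := le_add_of_nonneg_right (by positivity)

lemma sq_mul_le_energyConst_sq_of_mul_rate_le (hl : 0 < l) (hc : 0 < c) (hν : 0 < ν) (hk : k ≠ 0)
    (hδ : 0 < δ) {r : ℝ} (hr : ν * r ≤ (|k| * δ ^ (m + 1)) ^ 2) :
    (3 * δ / (|k| * (c * δ ^ m) * (l * δ)) * (4 * ν / (l * δ))) ^ 2 * r ≤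
      energyConst l c ^ 2 * ν := by
  have : 0 < |k| := abs_pos.2 hk
  calc (3 * δ / (|k| * (c * δ ^ m) * (l * δ)) * (4 * ν / (l * δ))) ^ 2 * r
      = (12 / (l ^ 2 * c)) ^ 2 * ν * (ν * r / (|k| * δ ^ (m + 1)) ^ 2) := by
        field_simp
        ring
    _ ≤ (12 / (l ^ 2 * c)) ^ 2 * ν * 1 := by
        gcongr
        exact div_le_one_of_le₀ hr (by positivity)
    _ ≤ energyConst l c ^ 2 * ν := by
        rw [mul_one]
        gcongr
        exact le_add_of_nonneg_left (by positivity)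

lemma LeavesLevels.rate_mul_sqrt_integral_le {S : Set ℝ} (hgeom : LeavesLevels v S m l c)
    (hl : 0 < l) (hc : 0 < c) (hν : 0 < ν) (hk : k ≠ 0) (s : ℝ) (hδ : 0 < δ) (hδ1 : δ ≤ 1)
    (hmix : rate m ν k ≤ |k| * δ ^ m) (hdiff : δ ^ 2 * rate m ν k ≤ ν)
    (hbal : ν * rate m ν k ≤ (|k| * δ ^ (m + 1)) ^ 2) {a : ℝ} {N : ℕ}
    (hS : Icc a (a + N * δ) ⊆ S) (hv : ContinuousOn v (Icc a (a + N * δ))) {G : ℝ → ℂ}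
    (hG : ContDiff ℝ 2 G) (ha : deriv G a = 0) (hb : deriv G (a + N * δ) = 0) :
    rate m ν k * √(∫ x in a..a + N * δ, ‖G x‖ ^ 2) ≤ resolventConst l c *
      √(∫ x in a..a + N * δ, ‖modelOp ν (fun x => k * v x - s) G x‖ ^ 2) := by
  have : 0 < |k| := abs_pos.2 hk
  refine interval_estimate hG (by positivity) hδ.le hν.le (by positivity) (rate_pos m hν hk)
    ((continuousOn_const.mul hv).sub continuousOn_const) (fun t hat htb => ?_) ha hb
    (le_energyConst_of_rate_le hl hc hk hδ hmix)
    (sq_mul_le_energyConst_sq_of_mul_rate_le hl hc hν hk hδ hbal) hdiff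
  have hlevel := (hgeom t δ (s / k) hδ hδ1 ((Icc_subset_Icc hat htb).trans hS)).const_mul hk
  simpa only [mul_sub, mul_div_cancel₀ s hk] using hlevel

lemma setIntegral_eq_intervalIntegral_of_support_subset {h : ℝ → ℝ} {a b : ℝ} {T : Set ℝ}
    (hab : a ≤ b) (hΩ : Ioo a b ⊆ (Ω : Set ℝ)) (hT : ∀ x ∈ (Ω : Set ℝ), x ∈ T → x ∈ Ioo a b)
    (hh : Function.support h ⊆ T) : ∫ x in (Ω : Set ℝ), h x = ∫ x in a..b, h x := by
  rw [intervalIntegral.integral_of_le hab, integral_Ioc_eq_integral_Ioo]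
  exact setIntegral_eq_of_subset_of_forall_sdiff_eq_zero Ω.isOpen.measurableSet hΩ
    fun x hx => Function.notMem_support.1 fun hxh => hx.2 (hT x hx.1 (hh hxh))

lemma support_norm_modelOp_sq_subset (ν : ℝ) (W : ℝ → ℝ) (G : ℝ → ℂ) :
    Function.support (fun x => ‖modelOp ν W G x‖ ^ 2) ⊆ tsupport G := fun x => by
  contrapose!
  intro hx
  have hG : G x = 0 := image_eq_zero_of_notMem_tsupport hx
  have hG'' : deriv (deriv G) x = 0 := image_eq_zero_of_notMem_tsupport fun h =>
    hx (tsupport_deriv_subset (𝕜 := ℝ) (tsupport_deriv_subset (𝕜 := ℝ) h))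
  simp [modelOp, hG, hG'']

lemma LeavesLevels.rate_mul_norm_le (hΩ : IsLineOrHalfLine Ω)
    (hgeom : LeavesLevels v (closure (Ω : Set ℝ)) m l c)
    (hv : ContinuousOn v (closure (Ω : Set ℝ))) (hl : 0 < l) (hc : 0 < c) (hν : 0 < ν)
    (hk : k ≠ 0) (s : ℝ) {g : neumannDomain Ω v} (hg : g ∈ neumannTests Ω v) :
    rate m ν k * ‖(g : X Ω)‖ ≤ resolventConst l c *
      ‖operatorCore Ω v ν k g - ((s : ℂ) * Complex.I) • (g : X Ω)‖ := by
  obtain ⟨G, hG, hgG⟩ := hg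
  obtain ⟨δ, hδ, hδ1, hmix, hdiff, hbal⟩ := exists_scale m hν hk
  obtain ⟨R, -, hR⟩ := exists_tsupport_subset_Ioo hG.hasCompactSupport
  obtain ⟨a, N, hcl, hint, ha, hb, hfill⟩ := hΩ.exists_filling_interval hδ R
  have hab : a ≤ a + N * δ := le_add_of_nonneg_right (by positivity)
  have hderiv : ∀ y, y ∈ frontier (Ω : Set ℝ) ∨ y ∉ Ioo (-R) R → deriv G y = 0 := fun y hy =>
    hy.elim (hG.deriv_eq_zero y) fun hy => image_eq_zero_of_notMem_tsupport fun h =>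
      hy (hR (tsupport_deriv_subset (𝕜 := ℝ) h))
  have hGsupp : Function.support (fun x => ‖G x‖ ^ 2) ⊆ Ioo (-R) R := fun x hx =>
    hR (subset_tsupport G fun hGx => hx (by simp [hGx]))
  rw [norm_eq_sqrt_integral hgG,
    norm_eq_sqrt_integral (operatorCore_sub_smul_ae_eq hG hgG ν k s),
    setIntegral_eq_intervalIntegral_of_support_subset hab hint hfill hGsupp,
    setIntegral_eq_intervalIntegral_of_support_subset hab hint hfill
      ((support_norm_modelOp_sq_subset _ _ G).trans hR)]
  exact hgeom.rate_mul_sqrt_integral_le hl hc hν hk s hδ hδ1 hmix hdiff hbal hcl (hv.mono hcl)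
    (contDiff_infty.1 hG.contDiff 2)
    (hderiv a (ha.imp_right fun h h' => h.not_gt h'.1))
    (hderiv _ (hb.imp_right fun h h' => h.not_gt h'.2))

end Resolvent

end ShearFlow

end

theorem mainTheorem3 (m : ℕ) (hm : 1 ≤ m) (Ω : TopologicalSpace.Opens ℝ)
    (hΩ : (Ω : Set ℝ) = Set.univ ∨ (∃ L₁ : ℝ, (Ω : Set ℝ) = Set.Iio L₁) ∨
      ∃ L₂ : ℝ, (Ω : Set ℝ) = Set.Ioi L₂)
    (v : ℝ → ℝ) (hv : ContDiffOn ℝ m v (closure (Ω : Set ℝ)))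
    (hnondeg : ∀ y ∈ closure (Ω : Set ℝ),
      0 < ∑ j ∈ Finset.Icc 1 m, |iteratedDerivWithin j v (closure (Ω : Set ℝ)) y|)
    (hinfty : ∃ c₀ : ℝ, 0 < c₀ ∧ ENNReal.ofReal c₀ ≤
      Filter.liminf (fun y => ENNReal.ofReal |derivWithin v (closure (Ω : Set ℝ)) y|)
        (Filter.cocompact ℝ ⊓ Filter.principal (closure (Ω : Set ℝ)))) :
    ∃ C : ℝ, 0 < C ∧ ∀ ν k : ℝ, 0 < ν → k ≠ 0 →
      ENNReal.ofReal (C * ShearFlow.rate m ν k) ≤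
        ShearFlow.pseudospectralAbscissa (ShearFlow.H Ω v ν k) := by
  obtain ⟨c₀, hc₀, hinfty⟩ := hinfty
  have hΩ' := ShearFlow.isLineOrHalfLine_of_eq hΩ
  have hvc := hv.continuousOn
  obtain ⟨l, c, hl, hc, hgeom⟩ := ShearFlow.exists_leavesLevels hΩ'.uniqueDiffOn_closure
    isClosed_closure hv hnondeg hc₀ hinfty
  have hK := ShearFlow.resolventConst_pos hl hc
  refine ⟨(ShearFlow.resolventConst l c)⁻¹, inv_pos.2 hK, fun ν k hν hk => ?_⟩
  have hC := mul_pos (inv_pos.2 hK) (ShearFlow.rate_pos m hν hk)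
  refine ShearFlow.le_pseudospectralAbscissa hC fun s => ?_
  refine ShearFlow.exists_isResolvent_closure (ShearFlow.isClosable_operatorCore hΩ' hvc ν k) hC
    (fun g hg => ?_) (ShearFlow.topologicalClosure_map_neumannTests hΩ' hvc hν.ne')
    fun g => ShearFlow.eq_zero_of_closure_eigenvector hΩ' hvc hν.ne'
  rw [mul_assoc, inv_mul_le_iff₀ hK]
  exact hgeom.rate_mul_norm_le hΩ' hvc hl hc hν hk s hg
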